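/- **Theorem.** All graphs are finite, simple and undirected. A proper coloring $V_1\uplus\cdots\uplus V_k$ of a graph $H$ is a *partial Grundy coloring of order $k$* if for every $i\in[k]$ there is $v_i\in V_i$ that has a neighbor in $V_j$ for every $j<i$; it is a *$b$-coloring of order $k$* if for every $i\in[k]$ there is $v_i\in V_i$ that has a neighbor in $V_j$ for every $j\neq i$. Given a graph $G$ and an integer $k>0$, the problem *Partial Grundy Coloring* (respectively *$b$-Chromatic Core*) asks whether there is a set $S\subseteq V(G)$ such that the induced subgraph $G[S]$ admits a partial Grundy coloring (respectively a $b$-coloring) of order $k$. For each of the two problems, *$b$-Chromatic Core* and *Partial Grundy Coloring*, there are a function $h:\mathbb N\times\mathbb N\to\mathbb N$, a constant $c$ and a single deterministic algorithm (on a random access machine with addition and subtraction at unit cost) which, given integers $k>0$ and $t$ and a graph $G$ on $n$ vertices, presented by its adjacency matrix, that does not contain $K_{t,t}$ as a (not necessarily induced) subgraph, decides in time at most $h(k,t)\cdot \max(n,1)^{c}$ whether $(G,k)$ is a yes-instance of the problem. That is, both problems are solvable in time $h(k,t)\cdot n^{O(1)}$ on $K_{t,t}$-free graphs. -/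

import Mathlib

/-! ### Partial Grundy colorings, b-colorings and the two decision problems -/

section Colorings

variable {V : Type*}

/-- A proper coloring of `G` with colors `0, …, k - 1` is a partial Grundy coloring of order `k` if
every color class `i` contains a vertex having a neighbor in each class `j < i`. -/
def IsPartialGrundyColoring (G : SimpleGraph V) (k : ℕ) (C : G.Coloring (Fin k)) : Prop :=
  ∀ i : Fin k, ∃ v : V, C v = i ∧ ∀ j : Fin k, j < i → ∃ u : V, G.Adj v u ∧ C u = j

/-- A proper coloring of `G` with `k` colors is a b-coloring of order `k` if every color class `i`
contains a vertex having a neighbor in each class `j ≠ i`. -/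
def IsBColoring (G : SimpleGraph V) (k : ℕ) (C : G.Coloring (Fin k)) : Prop :=
  ∀ i : Fin k, ∃ v : V, C v = i ∧ ∀ j : Fin k, j ≠ i → ∃ u : V, G.Adj v u ∧ C u = j

/-- The question of Partial Grundy Coloring on the instance `(G, k)`. -/
def PartialGrundyColoringProblem (G : SimpleGraph V) (k : ℕ) : Prop :=
  ∃ (S : Set V) (C : (G.induce S).Coloring (Fin k)), IsPartialGrundyColoring (G.induce S) k C

/-- The question of b-Chromatic Core on the instance `(G, k)`. -/
def BChromaticCoreProblem (G : SimpleGraph V) (k : ℕ) : Prop :=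
  ∃ (S : Set V) (C : (G.induce S).Coloring (Fin k)), IsBColoring (G.induce S) k C

end Colorings

/-! ### Random access machines

Programs are finite texts. They work on registers and on arrays (both named by literals of the
program text) that hold natural numbers; array cells are addressed indirectly. The only arithmetic
operations are addition and truncated subtraction, and the running time is the number of elementary
operations (unit cost). Without multiplication, this cost measure is polynomially related to the
running time of Turing machines. -/

namespace RAM

/-- Arithmetic expressions: literals, registers, sums, truncated differences, array look-ups. -/
inductive Expr : Type
  | const (c : ℕ) : Expr
  | reg (x : ℕ) : Expr
  | add (e₁ e₂ : Expr) : Expr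
  | sub (e₁ e₂ : Expr) : Expr
  | load (a : ℕ) (e : Expr) : Expr

/-- Programs. A test `e` succeeds if the value of `e` is nonzero. -/
inductive Prog : Type
  | skip : Prog
  | assign (x : ℕ) (e : Expr) : Prog
  | store (a : ℕ) (e₁ e₂ : Expr) : Prog
  | seq (p q : Prog) : Prog
  | branch (e : Expr) (p q : Prog) : Prog
  | loop (e : Expr) (p : Prog) : Prog

/-- A machine state: `regs x` is the content of register `x`, and `arrs a i` is the content of
cell `i` of array `a`. -/
structure State : Type where
  regs : ℕ → ℕ
  arrs : ℕ → ℕ → ℕ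

/-- The value of an expression. -/
def Expr.eval (s : State) : Expr → ℕ
  | .const c => c
  | .reg x => s.regs x
  | .add e₁ e₂ => e₁.eval s + e₂.eval s
  | .sub e₁ e₂ => e₁.eval s - e₂.eval s
  | .load a e => s.arrs a (e.eval s)

/-- The number of elementary operations needed to evaluate an expression. -/
def Expr.cost : Expr → ℕ
  | .const _ => 1
  | .reg _ => 1
  | .add e₁ e₂ => e₁.cost + e₂.cost + 1
  | .sub e₁ e₂ => e₁.cost + e₂.cost + 1
  | .load _ e => e.cost + 1

/-- Write the value `v` into register `x`. -/
def State.setReg (s : State) (x v : ℕ) : State :=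
  { s with regs := Function.update s.regs x v }

/-- Write the value `v` into cell `i` of array `a`. -/
def State.setArr (s : State) (a i v : ℕ) : State :=
  { s with arrs := Function.update s.arrs a (Function.update (s.arrs a) i v) }

/-- `Exec p s s' T`: started in state `s`, the program `p` halts in state `s'` after exactly `T`
elementary steps. -/
inductive Exec : Prog → State → State → ℕ → Prop
  | skip (s : State) : Exec .skip s s 1
  | assign (s : State) (x : ℕ) (e : Expr) :
      Exec (.assign x e) s (s.setReg x (e.eval s)) (e.cost + 1)
  | store (s : State) (a : ℕ) (e₁ e₂ : Expr) :
      Exec (.store a e₁ e₂) s (s.setArr a (e₁.eval s) (e₂.eval s)) (e₁.cost + e₂.cost + 1)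
  | seq {p q : Prog} {s₁ s₂ s₃ : State} {T₁ T₂ : ℕ} (hp : Exec p s₁ s₂ T₁)
      (hq : Exec q s₂ s₃ T₂) : Exec (.seq p q) s₁ s₃ (T₁ + T₂)
  | branchTrue {e : Expr} {p q : Prog} {s s' : State} {T : ℕ} (he : e.eval s ≠ 0)
      (hp : Exec p s s' T) : Exec (.branch e p q) s s' (e.cost + 1 + T)
  | branchFalse {e : Expr} {p q : Prog} {s s' : State} {T : ℕ} (he : e.eval s = 0)
      (hq : Exec q s s' T) : Exec (.branch e p q) s s' (e.cost + 1 + T)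
  | loopTrue {e : Expr} {p : Prog} {s₁ s₂ s₃ : State} {T₁ T₂ : ℕ} (he : e.eval s₁ ≠ 0)
      (hp : Exec p s₁ s₂ T₁) (hl : Exec (.loop e p) s₂ s₃ T₂) :
      Exec (.loop e p) s₁ s₃ (e.cost + 1 + T₁ + T₂)
  | loopFalse {e : Expr} {p : Prog} {s : State} (he : e.eval s = 0) :
      Exec (.loop e p) s s (e.cost + 1)

/-- Computations are deterministic, so that "the" final state and running time make sense. -/
theorem Exec.deterministic {p : Prog} {s s₁ : State} {T₁ : ℕ} (h₁ : Exec p s s₁ T₁) :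
    ∀ {s₂ : State} {T₂ : ℕ}, Exec p s s₂ T₂ → s₁ = s₂ ∧ T₁ = T₂ := by
  induction h₁ with
  | skip s => intro s₂ T₂ h; cases h; exact ⟨rfl, rfl⟩
  | assign s x e => intro s₂ T₂ h; cases h; exact ⟨rfl, rfl⟩
  | store s a e₁ e₂ => intro s₂ T₂ h; cases h; exact ⟨rfl, rfl⟩
  | seq hp hq ihp ihq =>
    intro s₂ T₂ h
    cases h with
    | seq hp' hq' =>
      obtain ⟨rfl, rfl⟩ := ihp hp'
      obtain ⟨rfl, rfl⟩ := ihq hq'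
      exact ⟨rfl, rfl⟩
  | branchTrue he hp ih =>
    intro s₂ T₂ h
    cases h with
    | branchTrue he' hp' => obtain ⟨rfl, rfl⟩ := ih hp'; exact ⟨rfl, rfl⟩
    | branchFalse he' hq' => exact absurd he' he
  | branchFalse he hq ih =>
    intro s₂ T₂ h
    cases h with
    | branchTrue he' hp' => exact absurd he he'
    | branchFalse he' hq' => obtain ⟨rfl, rfl⟩ := ih hq'; exact ⟨rfl, rfl⟩
  | loopTrue he hp hl ihp ihl =>
    intro s₂ T₂ h
    cases h with
    | loopTrue he' hp' hl' =>
      obtain ⟨rfl, rfl⟩ := ihp hp'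
      obtain ⟨rfl, rfl⟩ := ihl hl'
      exact ⟨rfl, rfl⟩
    | loopFalse he' => exact absurd he' he
  | loopFalse he =>
    intro s₂ T₂ h
    cases h with
    | loopTrue he' hp' hl' => exact absurd he he'
    | loopFalse he' => exact ⟨rfl, rfl⟩

open Classical in
/-- The initial state for the input `(G, k, t)`: the registers `0, 1, 2` hold `n, k, t`, array `0`
holds the adjacency matrix of `G` in row-major order, and everything else is `0`. -/
noncomputable def inputState {n : ℕ} (G : SimpleGraph (Fin n)) (k t : ℕ) : State where
  regs x := if x = 0 then n else if x = 1 then k else if x = 2 then t else 0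
  arrs a m :=
    if a = 0 ∧ ∃ i j : Fin n, m = (i : ℕ) * n + (j : ℕ) ∧ G.Adj i j then 1 else 0

open Classical in
/-- Started in state `s`, the program `p` halts within `T` steps and correctly answers, in
register `0`, whether the proposition `A` holds (`1` for yes, `0` for no). -/
def DecidesInTime (p : Prog) (s : State) (A : Prop) (T : ℕ) : Prop :=
  ∃ (s' : State) (T' : ℕ), Exec p s s' T' ∧ T' ≤ T ∧ s'.regs 0 = if A then 1 else 0

end RAM

/-!
A graph has an induced subgraph with one of the two colorings of order `k` if and only if it has a
witness with at most `k²` vertices: a distinguished vertex of every color, together with a neighbor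
of each of the colors that it has to see.

If many vertices have large degree, then such a witness exists. Since the graph is `K_{t,t}`-free,
the neighborhoods of suitable high-degree vertices remain large after the removal of the other
neighborhoods, and the remaining sets have a transversal that is independent.

Otherwise the set `A` of vertices of large degree is bounded. The other vertices are classified by
the isomorphism type of their closed neighborhood together with `A`; the number of types is bounded.
If more than a bounded number of vertices has the same type, then one of them is far from any
given witness, and a part of the witness can be moved there by a local isomorphism. Hence it is
enough to keep boundedly many vertices of each type, with their neighbors and `A`, and to search
this kernel by brute force.
-/

section Witnesses

variable {V W ι : Type*}

/-- A certificate for a coloring with the color set `ι` in which every color `i` has a vertex that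
sees all colors `j` with `R i j`: the vertex `x i j` has color `j`, the diagonal vertex `x i i` is
the distinguished vertex of color `i`, and it is adjacent to `x i j` whenever `R i j`. -/
structure IsColoringWitness (G : SimpleGraph V) (R : ι → ι → Prop) (x : ι → ι → V) : Prop where
  adj : ∀ i j, R i j → G.Adj (x i i) (x i j)
  not_adj : ∀ i i' j, ¬ G.Adj (x i j) (x i' j)
  ne : ∀ i i' j j', j ≠ j' → x i j ≠ x i' j'

variable {G : SimpleGraph V} {R : ι → ι → Prop}

theorem IsColoringWitness.color_eq {x : ι → ι → V} (hx : IsColoringWitness G R x) {i i' j j' : ι}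
    (h : x i j = x i' j') : j = j' :=
  not_imp_comm.1 (hx.ne i i' j j') (not_not.2 h)

theorem isColoringWitness_map_iff (f : V ↪ W) {x : ι → ι → V} :
    IsColoringWitness (G.map f) R (fun i j => f (x i j)) ↔ IsColoringWitness G R x :=
  ⟨fun h => ⟨by simpa using h.adj, by simpa using h.not_adj, by simpa using h.ne⟩,
    fun h => ⟨by simpa using h.adj, by simpa using h.not_adj, by simpa using h.ne⟩⟩

theorem exists_isColoringWitness_of_coloring (hR : ∀ i, ¬ R i i) {S : Set V}
    (C : (G.induce S).Coloring ι)
    (hC : ∀ i, ∃ v, C v = i ∧ ∀ j, R i j → ∃ u, (G.induce S).Adj v u ∧ C u = j) :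
    ∃ x, IsColoringWitness G R x := by
  classical
  choose v hv u hadj hu using hC
  let y : ι → ι → S := fun i j => if h : R i j then u i j h else v j
  have color_y (i j : ι) : C (y i j) = j := by
    by_cases h : R i j <;> simp [y, h, hu, hv]
  refine ⟨fun i j => y i j, fun i j hij => ?_, fun i i' j h => ?_, fun i i' j j' hjj' h => ?_⟩
  · simpa [y, hR, hij] using hadj i j hij
  · exact C.valid (v := y i j) (w := y i' j) h (by rw [color_y, color_y])
  · exact hjj' (by rw [← color_y i j, ← color_y i' j', Subtype.ext h])

theorem IsColoringWitness.exists_coloring {x : ι → ι → V} (hx : IsColoringWitness G R x) :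
    ∃ (S : Set V) (C : (G.induce S).Coloring ι), ∀ i, ∃ v, C v = i ∧
      ∀ j, R i j → ∃ u, (G.induce S).Adj v u ∧ C u = j := by
  let S : Set V := {v | ∃ j i, x i j = v}
  choose color row hcolor using fun v : S => v.2
  let y (i j : ι) : S := ⟨x i j, j, i, rfl⟩
  have color_y (i j : ι) : color (y i j) = j := hx.color_eq (hcolor (y i j))
  refine ⟨S, .mk color fun {v w} hvw hcol => ?_, fun i => ⟨y i i, color_y i i, fun j hij =>
    ⟨y i j, hx.adj i j hij, color_y i j⟩⟩⟩
  have : G.Adj v w := hvw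
  rw [← hcolor v, ← hcolor w, hcol] at this
  exact hx.not_adj _ _ _ this

theorem exists_coloring_iff_exists_isColoringWitness (hR : ∀ i, ¬ R i i) :
    (∃ (S : Set V) (C : (G.induce S).Coloring ι), ∀ i, ∃ v, C v = i ∧
      ∀ j, R i j → ∃ u, (G.induce S).Adj v u ∧ C u = j) ↔ ∃ x, IsColoringWitness G R x :=
  ⟨fun ⟨_, C, hC⟩ => exists_isColoringWitness_of_coloring hR C hC,
    fun ⟨_, hx⟩ => hx.exists_coloring⟩

theorem bChromaticCoreProblem_iff {k : ℕ} :
    BChromaticCoreProblem G k ↔ ∃ x : Fin k → Fin k → V, IsColoringWitness G (fun i j => j ≠ i) x :=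
  exists_coloring_iff_exists_isColoringWitness (by simp)

theorem partialGrundyColoringProblem_iff {k : ℕ} :
    PartialGrundyColoringProblem G k ↔
      ∃ x : Fin k → Fin k → V, IsColoringWitness G (fun i j => j < i) x :=
  exists_coloring_iff_exists_isColoringWitness (by simp)

theorem isColoringWitness_of_leaves [DecidableEq ι]
    (hR : ∀ i, ¬ R i i) {v : ι → V} {u : ι × ι → V} (hv : v.Injective)
    (hadj : ∀ i j, i ≠ j → G.Adj (v i) (u (i, j)))
    (hnot : ∀ i j, i ≠ j → ¬ G.Adj (v j) (u (i, j)))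
    (hne : ∀ i j l, i ≠ j → v l ≠ u (i, j))
    (hu : (Set.univ : Set ι).offDiag.Pairwise fun p q => u p ≠ u q ∧ ¬ G.Adj (u p) (u q)) :
    IsColoringWitness G R fun i j => if i = j then v i else u (i, j) := by
  have hu' (i j i' j' : ι) (h : i ≠ j) (h' : i' ≠ j') (hp : (i, j) ≠ (i', j')) :=
    hu (x := (i, j)) (y := (i', j')) (by simpa using h) (by simpa using h') hp
  refine ⟨fun i j hij => ?_, fun i i' j => ?_, fun i i' j j' hjj' => ?_⟩
  · have : i ≠ j := fun h => hR i (h ▸ hij)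
    simpa [this] using hadj i j this
  · by_cases h : i = j <;> by_cases h' : i' = j
    · simp [h, h']
    · simpa [h, h'] using hnot i' j h'
    · simpa [h, h', G.adj_comm] using hnot i j h
    · rcases eq_or_ne i i' with rfl | hii'
      · simp
      · simpa [h, h'] using (hu' i j i' j h h' (by simp [hii'])).2
  · by_cases h : i = j <;> by_cases h' : i' = j'
    · simpa [h, h'] using hv.ne hjj'
    · simpa [h, h'] using hne i' j' j h'
    · simpa [h, h'] using (hne i j j' h).symm
    · simpa [h, h'] using (hu' i j i' j' h h' (by simp [hjj'])).1

end Witnesses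

section HighDegree

variable {V : Type*} [DecidableEq V] {G : SimpleGraph V} [G.LocallyFinite] {t : ℕ}

theorem card_lt_of_card_sdiff_neighborFinset_le
    (hG : (completeBipartiteGraph (Fin t) (Fin t)).Free G) {B U : Finset V} {g : ℕ}
    (hB : t * g + t ≤ B.card) (hU : ∀ u ∈ U, (B \ G.neighborFinset u).card ≤ g) : U.card < t := by
  by_contra! hcard
  obtain ⟨L, hLU, hL⟩ := Finset.exists_subset_card_eq hcard
  let missed := L.biUnion fun u => B \ G.neighborFinset u
  have hmissed : missed.card ≤ t * g :=
    hL ▸ Finset.card_biUnion_le_card_mul _ _ _ fun u hu => hU u (hLU hu)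
  obtain ⟨L', hL'B, hL'⟩ := Finset.exists_subset_card_eq (n := t) (s := B \ missed) <| by
    have := Finset.le_card_sdiff missed B
    omega
  refine hG (SimpleGraph.completeBipartiteGraph_isContained_iff.2
    ⟨L, L', by simpa using hL, by simpa using hL', fun u hu w hw => ?_⟩)
  have hw' := hL'B hw
  simp only [missed, Finset.mem_sdiff, Finset.mem_biUnion, SimpleGraph.mem_neighborFinset,
    not_exists, not_and, not_not] at hw'
  exact hw'.2 u hu hw'.1

theorem exists_mem_forall_lt_card_sdiff_neighborFinset {ι : Type*}
    (hG : (completeBipartiteGraph (Fin t) (Fin t)).Free G) {g : ℕ} {B₀ : Finset V} {I : Finset ι}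
    {B : ι → Finset V} (hB₀ : I.card * t < B₀.card) (hB : ∀ i ∈ I, t * g + t ≤ (B i).card) :
    ∃ u ∈ B₀, ∀ i ∈ I, g < (B i \ G.neighborFinset u).card := by
  let bad (i : ι) : Finset V := B₀.filter fun u => (B i \ G.neighborFinset u).card ≤ g
  have hbad (i : ι) (hi : i ∈ I) : (bad i).card ≤ t :=
    (card_lt_of_card_sdiff_neighborFinset_le hG (hB i hi) fun u hu => (Finset.mem_filter.1 hu).2).le
  obtain ⟨u, hu, hu'⟩ := Finset.exists_mem_notMem_of_card_lt_card
    ((Finset.card_biUnion_le_card_mul I bad t hbad).trans_lt hB₀)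
  refine ⟨u, hu, fun i hi => not_le.1 fun hle => hu' ?_⟩
  exact Finset.mem_biUnion.2 ⟨i, hi, Finset.mem_filter.2 ⟨hu, hle⟩⟩

omit [DecidableEq V] in
/-- The vertices are chosen one by one; each choice shrinks the sizes of the remaining sets from
`g ^ 2` to no less than `g`. -/
theorem exists_independent_transversal [Nonempty V]
    (hG : (completeBipartiteGraph (Fin t) (Fin t)).Free G) {ι : Type*}
    {b : ℕ} (I : Finset ι) (hb : t + I.card + 2 ≤ b) (B : ι → Finset V)
    (hB : ∀ i ∈ I, b ^ 2 ^ I.card ≤ (B i).card) :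
    ∃ u : ι → V, (∀ i ∈ I, u i ∈ B i) ∧
      (I : Set ι).Pairwise fun i j => u i ≠ u j ∧ ¬ G.Adj (u i) (u j) := by
  classical
  induction I using Finset.induction_on generalizing B with
  | empty => exact ⟨fun _ => Classical.arbitrary V, by simp⟩
  | insert i₀ I hi₀ ih =>
    rw [Finset.card_insert_of_notMem hi₀] at hb hB
    set g := b ^ 2 ^ I.card
    have hbg : b ≤ g := Nat.le_self_pow (by positivity) b
    have hgg : b ^ 2 ^ (I.card + 1) = g * g := by rw [pow_succ, pow_mul, sq]
    have hsq : (t + (I.card + 2)) * g ≤ g * g := Nat.mul_le_mul_right _ (by omega)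
    have hIt : I.card * t ≤ I.card * g := Nat.mul_le_mul_left _ (by omega)
    simp only [Finset.forall_mem_insert, hgg] at hB
    obtain ⟨u₀, hu₀, hlarge⟩ := exists_mem_forall_lt_card_sdiff_neighborFinset hG (g := g)
      (B₀ := B i₀) (I := I) (B := B) (by nlinarith [hB.1]) (fun i hi => by nlinarith [hB.2 i hi])
    obtain ⟨u, hu, hpair⟩ := ih (by omega) (fun i => (B i \ G.neighborFinset u₀).erase u₀)
      fun i hi => (Nat.le_sub_one_of_lt (hlarge i hi)).trans Finset.pred_card_le_card_erase
    simp only [Finset.mem_erase, Finset.mem_sdiff, SimpleGraph.mem_neighborFinset] at hu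
    have hupd : ∀ i ∈ I, Function.update u i₀ u₀ i = u i := fun i hi =>
      Function.update_of_ne (ne_of_mem_of_not_mem hi hi₀) _ _
    refine ⟨Function.update u i₀ u₀, ?_, ?_⟩
    · rw [Finset.forall_mem_insert, Function.update_self]
      exact ⟨hu₀, fun i hi => by rw [hupd i hi]; exact (hu i hi).2.1⟩
    · rw [Finset.coe_insert, Set.pairwise_insert]
      refine ⟨fun i hi j hj hij => ?_, fun i hi _ => ?_⟩
      · simpa only [hupd i hi, hupd j hj] using hpair hi hj hij
      · rw [Function.update_self, hupd i hi, G.adj_comm (u i)]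
        exact ⟨⟨(hu i hi).1.symm, (hu i hi).2.2⟩, (hu i hi).1, (hu i hi).2.2⟩

theorem card_neighborFinset_sdiff_le_of_degree_le {v w : V} (h : G.degree v ≤ G.degree w) :
    (G.neighborFinset v \ G.neighborFinset w).card ≤
      (G.neighborFinset w \ G.neighborFinset v).card :=
  Finset.card_sdiff_le_card_sdiff_iff.2 h

theorem exists_subset_pairwise_lt_card_neighborFinset_sdiff
    (hG : (completeBipartiteGraph (Fin t) (Fin t)).Free G) {g : ℕ} (m : ℕ) (X : Finset V)
    (hX : m * t ≤ X.card) (hdeg : ∀ v ∈ X, t * g + t ≤ G.degree v) :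
    ∃ Y ⊆ X, Y.card = m ∧ (Y : Set V).Pairwise fun v w =>
      g < (G.neighborFinset v \ G.neighborFinset w).card := by
  induction m generalizing X with
  | zero => exact ⟨∅, by simp⟩
  | succ m ih =>
    have ht : 0 < t := Nat.pos_of_ne_zero fun h => by
      subst h
      simpa using card_lt_of_card_sdiff_neighborFinset_le hG (B := ∅) (U := ∅) (g := 0)
    obtain ⟨v₀, hv₀, hmin⟩ := X.exists_min_image (fun v => G.degree v)
      (Finset.card_pos.1 (by nlinarith))
    let near := X.filter fun w => (G.neighborFinset v₀ \ G.neighborFinset w).card ≤ g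
    have hnear : near.card < t := card_lt_of_card_sdiff_neighborFinset_le hG (hdeg v₀ hv₀)
      fun w hw => (Finset.mem_filter.1 hw).2
    obtain ⟨Y, hY, hcard, hpair⟩ := ih (X \ near)
      (by have := Finset.le_card_sdiff near X; rw [add_mul] at hX; omega)
      (fun v hv => hdeg v (Finset.mem_sdiff.1 hv).1)
    have hlt (w : V) (hw : w ∈ Y) : g < (G.neighborFinset v₀ \ G.neighborFinset w).card := by
      have := hY hw
      simp only [near, Finset.mem_sdiff, Finset.mem_filter, not_and, not_le] at this
      exact this.2 this.1
    have hv₀Y : v₀ ∉ Y := fun h => by simpa using hlt v₀ h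
    refine ⟨insert v₀ Y, Finset.insert_subset hv₀ (hY.trans Finset.sdiff_subset),
      by rw [Finset.card_insert_of_notMem hv₀Y, hcard], ?_⟩
    rw [Finset.coe_insert, Set.pairwise_insert]
    exact ⟨hpair, fun w hw _ => ⟨hlt w hw, (hlt w hw).trans_le
      (card_neighborFinset_sdiff_le_of_degree_le (hmin w (Finset.mem_sdiff.1 (hY hw)).1))⟩⟩

/-- The degree from which vertices count as high in instances with parameters `k` and `t`. It is the
square of the set size for which `exists_independent_transversal` applies to `k ^ 2` sets. -/
def degreeThreshold (k t : ℕ) : ℕ := (k * k + k + t + 2) ^ 2 ^ (k * k + 1)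

theorem mul_self_lt_degreeThreshold (k t : ℕ) : k * k < degreeThreshold k t :=
  (show k * k < k * k + k + t + 2 by omega).trans_le
    (Nat.le_self_pow (Nat.two_pow_pos _).ne' _)

theorem exists_isColoringWitness_of_pairwise_lt_card_sdiff
    (hG : (completeBipartiteGraph (Fin t) (Fin t)).Free G) {ι : Type*} [Fintype ι]
    {R : ι → ι → Prop} (hR : ∀ i, ¬ R i i) {b : ℕ}
    (hb : t + Fintype.card ι * Fintype.card ι + 2 ≤ b) {v : ι → V} (hv : v.Injective)
    (hvv : Pairwise fun i j => b ^ 2 ^ (Fintype.card ι * Fintype.card ι) + Fintype.card ι <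
      (G.neighborFinset (v i) \ G.neighborFinset (v j)).card) :
    ∃ x, IsColoringWitness G R x := by
  classical
  rcases isEmpty_or_nonempty ι with hι | ⟨⟨i₀⟩⟩
  · exact ⟨isEmptyElim, isEmptyElim, isEmptyElim, isEmptyElim⟩
  have : Nonempty V := ⟨v i₀⟩
  have hpairs : (Finset.univ : Finset ι).offDiag.card ≤ Fintype.card ι * Fintype.card ι := by
    rw [Finset.offDiag_card]
    exact Nat.sub_le _ _
  obtain ⟨u, hu, hpair⟩ := exists_independent_transversal hG (b := b) Finset.univ.offDiag
    (by omega) (fun p => (G.neighborFinset (v p.1) \ G.neighborFinset (v p.2)) \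
      Finset.univ.image v) fun p hp => by
        have h₁ := hvv (Finset.mem_offDiag.1 hp).2.2
        have h₂ := Finset.le_card_sdiff (Finset.univ.image v)
          (G.neighborFinset (v p.1) \ G.neighborFinset (v p.2))
        have h₃ : (Finset.univ.image v).card ≤ Fintype.card ι := Finset.card_image_le
        have h₄ : b ^ 2 ^ (Finset.univ : Finset ι).offDiag.card ≤
            b ^ 2 ^ (Fintype.card ι * Fintype.card ι) :=
          Nat.pow_le_pow_right (by omega) (Nat.pow_le_pow_right two_pos hpairs)
        omega
  have hu' (i j : ι) (hij : i ≠ j) : (G.Adj (v i) (u (i, j)) ∧ ¬ G.Adj (v j) (u (i, j))) ∧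
      ∀ l, v l ≠ u (i, j) := by
    simpa using hu (i, j) (by simpa using hij)
  exact ⟨_, isColoringWitness_of_leaves hR hv (fun i j h => (hu' i j h).1.1)
    (fun i j h => (hu' i j h).1.2) (fun i j l h => (hu' i j h).2 l) (by simpa using hpair)⟩

omit [DecidableEq V] in
theorem exists_isColoringWitness_of_degreeThreshold_le_card
    (hG : (completeBipartiteGraph (Fin t) (Fin t)).Free G) {ι : Type*} [Fintype ι]
    {R : ι → ι → Prop} (hR : ∀ i, ¬ R i i) {X : Finset V}
    (hX : degreeThreshold (Fintype.card ι) t ≤ X.card)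
    (hdeg : ∀ v ∈ X, degreeThreshold (Fintype.card ι) t ≤ G.degree v) :
    ∃ x, IsColoringWitness G R x := by
  classical
  set k := Fintype.card ι with hk
  set b := k * k + k + t + 2 with hb
  set g := b ^ 2 ^ (k * k) with hg
  have hbg : b ≤ g := Nat.le_self_pow (by positivity) b
  have hthreshold : degreeThreshold k t = g * g := by
    rw [degreeThreshold, pow_succ, pow_mul, sq]
  have hsq : (k + t + 2) * g ≤ g * g := Nat.mul_le_mul_right _ (by omega)
  have hkt : (k + 1) * t ≤ (k + 1) * g := Nat.mul_le_mul_left _ (by omega)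
  have htg : t * k + t ≤ g * g := by nlinarith
  rw [hthreshold] at hX hdeg
  obtain ⟨Y, -, hcard, hpair⟩ := exists_subset_pairwise_lt_card_neighborFinset_sdiff hG
    (g := g + k) k X (by nlinarith) (fun v hv => (hdeg v hv).trans' (by nlinarith))
  let v : ι ≃ Y := Fintype.equivOfCardEq (by rw [Fintype.card_coe, hcard])
  exact exists_isColoringWitness_of_pairwise_lt_card_sdiff hG hR (b := b)
    (by rw [← hk]; omega)
    (Subtype.val_injective.comp v.injective) fun i j hij =>
      hpair (v i).2 (v j).2 (Subtype.val_injective.ne (v.injective.ne hij))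

end HighDegree

section Kernel

variable {V ι : Type*} {G : SimpleGraph V} {A : Finset V} {u v r : V} {φ : V → V}

/-- The vertices of `A` together with the closed neighborhood of `u`. -/
def starSet (G : SimpleGraph V) (A : Finset V) (u : V) : Set V := A ∪ insert u (G.neighborSet u)

/-- The map `φ` fixes `A` pointwise, sends `u` to `v`, and is an isomorphism from the subgraph
induced by `A` and the closed neighborhood of `u` onto its image. -/
structure IsLocalIso (G : SimpleGraph V) (A : Finset V) (u v : V) (φ : V → V) : Prop where
  fix : ∀ a ∈ A, φ a = a
  map_center : φ u = v
  injOn : (starSet G A u).InjOn φ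
  adj_iff : ∀ y ∈ starSet G A u, ∀ z ∈ starSet G A u, (G.Adj (φ y) (φ z) ↔ G.Adj y z)

theorem IsLocalIso.map_notMem (hφ : IsLocalIso G A u v φ) {y : V} (hy : y ∈ starSet G A u)
    (hyA : y ∉ A) : φ y ∉ A := fun h =>
  hyA (hφ.injOn (Or.inl h) hy (hφ.fix _ h) ▸ h)

theorem IsLocalIso.map_mem (hφ : IsLocalIso G A u v φ) {y : V}
    (hy : y ∈ insert u (G.neighborSet u)) : φ y ∈ insert v (G.neighborSet v) := by
  rcases hy with rfl | hy
  · exact Or.inl hφ.map_center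
  · refine Or.inr ?_
    rw [← hφ.map_center, SimpleGraph.mem_neighborSet]
    exact (hφ.adj_iff u (Or.inr (Or.inl rfl)) y (Or.inr (Or.inr hy))).2 hy

variable {R : ι → ι → Prop} {x : ι → ι → V} {U : Set (ι × ι)}

/-- The positions `U` of the witness `x` can be moved together along a local isomorphism with
center `r`: all of them lie around `r`, and every required edge that leaves `U` ends in `A`. -/
structure IsMovable (G : SimpleGraph V) (A : Finset V) (R : ι → ι → Prop) (x : ι → ι → V) (r : V)
    (U : Set (ι × ι)) : Prop where
  notMem : ∀ i j, (i, j) ∈ U → x i j ∉ A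
  near : ∀ i j, (i, j) ∈ U → x i j ∈ insert r (G.neighborSet r)
  leaf : ∀ i j, R i j → (i, i) ∈ U → (i, j) ∈ U ∨ x i j ∈ A
  center : ∀ i j, R i j → (i, j) ∈ U → (i, i) ∈ U ∨ x i i ∈ A

open Classical in
/-- The witness `x` with the positions in `U` moved along `φ`. -/
noncomputable def moved (φ : V → V) (x : ι → ι → V) (U : Set (ι × ι)) (i j : ι) : V :=
  if (i, j) ∈ U then φ (x i j) else x i j

theorem moved_of_mem {i j : ι} (h : (i, j) ∈ U) : moved φ x U i j = φ (x i j) := if_pos h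

theorem moved_of_notMem {i j : ι} (h : (i, j) ∉ U) : moved φ x U i j = x i j := if_neg h

theorem IsMovable.moved_eq (hU : IsMovable G A R x r U) (hφ : IsLocalIso G A r v φ) {i j : ι}
    (h : (i, j) ∈ U ∨ x i j ∈ A) :
    moved φ x U i j = φ (x i j) ∧ x i j ∈ starSet G A r := by
  rcases h with h | h
  · exact ⟨moved_of_mem h, Or.inr (hU.near i j h)⟩
  · rw [moved_of_notMem fun h' => hU.notMem i j h' h, hφ.fix _ h]
    exact ⟨rfl, Or.inl h⟩

theorem IsMovable.moved_adj_iff (hU : IsMovable G A R x r U) (hφ : IsLocalIso G A r v φ)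
    {i j i' j' : ι} (h : (i, j) ∈ U ∨ x i j ∈ A) (h' : (i', j') ∈ U ∨ x i' j' ∈ A) :
    (G.Adj (moved φ x U i j) (moved φ x U i' j') ↔ G.Adj (x i j) (x i' j')) ∧
      (moved φ x U i j = moved φ x U i' j' ↔ x i j = x i' j') := by
  obtain ⟨h₁, h₂⟩ := hU.moved_eq hφ h
  obtain ⟨h₁', h₂'⟩ := hU.moved_eq hφ h'
  rw [h₁, h₁']
  exact ⟨hφ.adj_iff _ h₂ _ h₂', hφ.injOn.eq_iff h₂ h₂'⟩

/-- The vertex `v` is so far from the vertices of the witness `x` outside `A` that its neighborhood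
outside `A` contains none of them and none of their neighbors. -/
def IsFar (G : SimpleGraph V) (A : Finset V) (x : ι → ι → V) (v : V) : Prop :=
  ∀ y ∈ insert v (G.neighborSet v), y ∉ A → ∀ i j, x i j ∉ A → y ≠ x i j ∧ ¬ G.Adj y (x i j)

theorem IsMovable.moved_pair (hU : IsMovable G A R x r U) (hφ : IsLocalIso G A r v φ)
    (hfar : IsFar G A x v) (i j i' j' : ι) :
    (G.Adj (moved φ x U i j) (moved φ x U i' j') → G.Adj (x i j) (x i' j')) ∧
      (moved φ x U i j = moved φ x U i' j' → x i j = x i' j') := by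
  have separated {i j i' j' : ι} (h : (i, j) ∈ U) (h' : (i', j') ∉ U) (hA : x i' j' ∉ A) :
      moved φ x U i j ≠ moved φ x U i' j' ∧ ¬ G.Adj (moved φ x U i j) (moved φ x U i' j') := by
    rw [moved_of_mem h, moved_of_notMem h']
    exact hfar _ (hφ.map_mem (hU.near i j h))
      (hφ.map_notMem (Or.inr (hU.near i j h)) (hU.notMem i j h)) i' j' hA
  by_cases h : (i, j) ∈ U ∨ x i j ∈ A <;> by_cases h' : (i', j') ∈ U ∨ x i' j' ∈ A
  · exact ⟨(hU.moved_adj_iff hφ h h').1.1, (hU.moved_adj_iff hφ h h').2.1⟩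
  · rw [not_or] at h'
    rcases em ((i, j) ∈ U) with hij | hij
    · exact ⟨fun e => absurd e (separated hij h'.1 h'.2).2,
        fun e => absurd e (separated hij h'.1 h'.2).1⟩
    · simp [moved_of_notMem hij, moved_of_notMem h'.1]
  · rw [not_or] at h
    rcases em ((i', j') ∈ U) with hij | hij
    · exact ⟨fun e => absurd e.symm (separated hij h.1 h.2).2,
        fun e => absurd e.symm (separated hij h.1 h.2).1⟩
    · simp [moved_of_notMem hij, moved_of_notMem h.1]
  · rw [not_or] at h h'
    simp [moved_of_notMem h.1, moved_of_notMem h'.1]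

theorem IsMovable.isColoringWitness_moved (hU : IsMovable G A R x r U)
    (hx : IsColoringWitness G R x) (hφ : IsLocalIso G A r v φ) (hfar : IsFar G A x v) :
    IsColoringWitness G R (moved φ x U) := by
  refine ⟨fun i j hij => ?_, fun i i' j h => ?_, fun i i' j j' hjj' h => ?_⟩
  · by_cases h : ((i, i) ∈ U ∨ x i i ∈ A) ∧ ((i, j) ∈ U ∨ x i j ∈ A)
    · exact (hU.moved_adj_iff hφ h.1 h.2).1.2 (hx.adj i j hij)
    · have hleaf := hU.leaf i j hij
      have hcenter := hU.center i j hij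
      rw [moved_of_notMem (i := i) (j := i) (by tauto), moved_of_notMem (by tauto)]
      exact hx.adj i j hij
  · exact hx.not_adj i i' j ((hU.moved_pair hφ hfar i j i' j).1 h)
  · exact hx.ne i i' j j' hjj' ((hU.moved_pair hφ hfar i j i' j').2 h)

/-- The set to be moved is a distinguished vertex with its neighbors, or a single vertex if the
distinguished vertex belongs to `A`. -/
theorem IsColoringWitness.exists_isMovable (hx : IsColoringWitness G R x) {i₀ j₀ : ι}
    (h₀ : x i₀ j₀ ∉ A) :
    ∃ (i j : ι) (U : Set (ι × ι)), (i₀, j₀) ∈ U ∧ x i j ∉ A ∧ IsMovable G A R x (x i j) U := by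
  by_cases hc : x i₀ i₀ ∉ A ∧ (j₀ = i₀ ∨ R i₀ j₀)
  · refine ⟨i₀, i₀, {p | p.1 = i₀ ∧ (p.2 = i₀ ∨ R i₀ p.2) ∧ x p.1 p.2 ∉ A}, ⟨rfl, hc.2, h₀⟩, hc.1,
      fun i j h => h.2.2, ?_, ?_, ?_⟩
    · rintro i j ⟨rfl, h | hR, -⟩
      · exact Or.inl (congrArg (x i) h)
      · exact Or.inr (hx.adj i j hR)
    · rintro i j hR ⟨rfl, -⟩
      exact or_iff_not_imp_right.2 fun h => ⟨rfl, Or.inr hR, h⟩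
    · rintro i j _ ⟨rfl, -⟩
      exact Or.inl ⟨rfl, Or.inl rfl, hc.1⟩
  · refine ⟨i₀, j₀, {(i₀, j₀)}, rfl, h₀, ?_, ?_, ?_, ?_⟩
    · rintro i j ⟨rfl, rfl⟩
      exact h₀
    · rintro i j ⟨rfl, rfl⟩
      exact Or.inl rfl
    · rintro i j _ ⟨rfl, rfl⟩
      exact absurd ⟨h₀, Or.inl rfl⟩ hc
    · rintro i j hR ⟨rfl, rfl⟩
      exact Or.inr (by tauto)

variable [DecidableEq V] [G.LocallyFinite] [Fintype ι] {M : ℕ}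

omit [DecidableEq V] in
/-- A vertex that is not far is at distance at most two, along vertices of small degree outside
`A`, from one of the vertices of the witness. -/
theorem exists_mem_isFar (hlow : ∀ w, w ∉ A → G.degree w < M) (x : ι → ι → V) {F : Finset V}
    (hF : Fintype.card ι * Fintype.card ι * (M * M) < F.card) : ∃ w ∈ F, IsFar G A x w := by
  classical
  let ball (w : V) : Finset V := insert w (G.neighborFinset w)
  have card_ball (w : V) (hw : w ∉ A) : (ball w).card ≤ M :=
    (Finset.card_insert_le _ _).trans (hlow w hw)
  have mem_ball {w y : V} (h : y = w ∨ G.Adj w y) : y ∈ ball w := by simpa [ball] using h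
  let near : Finset V := (Finset.univ.filter fun p : ι × ι => x p.1 p.2 ∉ A).biUnion fun p =>
    ((ball (x p.1 p.2)).filter (· ∉ A)).biUnion ball
  have hnear : near.card ≤ Fintype.card ι * Fintype.card ι * (M * M) := by
    refine (Finset.card_biUnion_le_card_mul _ _ (M * M) fun p hp => ?_).trans
      (Nat.mul_le_mul_right _ ((Finset.card_filter_le _ _).trans_eq (Fintype.card_prod ι ι)))
    refine (Finset.card_biUnion_le_card_mul _ _ M fun w hw =>
      card_ball w (Finset.mem_filter.1 hw).2).trans (Nat.mul_le_mul_right _ ?_)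
    exact (Finset.card_filter_le _ _).trans (card_ball _ (Finset.mem_filter.1 hp).2)
  obtain ⟨w, hwF, hw⟩ := Finset.exists_mem_notMem_of_card_lt_card (hnear.trans_lt hF)
  refine ⟨w, hwF, fun y hy hyA i j hij => ?_⟩
  rw [← not_or]
  refine fun h => hw (Finset.mem_biUnion.2 ⟨(i, j), by simpa using hij, ?_⟩)
  exact Finset.mem_biUnion.2 ⟨y,
    Finset.mem_filter.2 ⟨mem_ball (h.imp_right SimpleGraph.Adj.symm), hyA⟩,
    mem_ball (hy.imp Eq.symm SimpleGraph.Adj.symm)⟩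

variable {S W D : Finset V}

theorem IsColoringWitness.exists_forall_mem (hx : IsColoringWitness G R x) (hxD : ∀ i j, x i j ∈ D)
    (hlow : ∀ w, w ∉ A → G.degree w < M)
    (htypes : ∀ u ∈ D, u ∉ A → u ∉ S → ∃ F ⊆ S,
      Fintype.card ι * Fintype.card ι * (M * M) < F.card ∧ ∀ w ∈ F, ∃ φ, IsLocalIso G A u w φ)
    (hWD : W ⊆ D) (hAW : A ⊆ W) (hSW : ∀ w ∈ S, insert w (G.neighborFinset w) ⊆ W) :
    ∃ x', IsColoringWitness G R x' ∧ ∀ i j, x' i j ∈ W := by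
  induction hb : (Finset.univ.filter fun p : ι × ι => x p.1 p.2 ∉ W).card
    using Nat.strong_induction_on generalizing x with
  | _ b ih =>
  by_cases hall : ∀ i j, x i j ∈ W
  · exact ⟨x, hx, hall⟩
  push Not at hall
  obtain ⟨i₀, j₀, h₀⟩ := hall
  have hmemW {w y : V} (hw : w ∈ S) (hy : y ∈ insert w (G.neighborSet w)) : y ∈ W :=
    hSW w hw (by simpa using hy)
  obtain ⟨i, j, U, h₀U, hA, hU⟩ := hx.exists_isMovable fun h => h₀ (hAW h)
  have hS : x i j ∉ S := fun h => h₀ (hmemW h (hU.near i₀ j₀ h₀U))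
  obtain ⟨F, hFS, hFcard, hF⟩ := htypes _ (hxD i j) hA hS
  obtain ⟨w, hwF, hfar⟩ := exists_mem_isFar hlow x hFcard
  obtain ⟨φ, hφ⟩ := hF w hwF
  have hmoved (i j : ι) : moved φ x U i j ∈ W ∨ (i, j) ∉ U := by
    by_cases h : (i, j) ∈ U
    · exact Or.inl (moved_of_mem (φ := φ) h ▸ hmemW (hFS hwF) (hφ.map_mem (hU.near i j h)))
    · exact Or.inr h
  refine ih _ ?_ (hU.isColoringWitness_moved hx hφ hfar) (fun i j => ?_) rfl
  · rw [← hb]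
    refine Finset.card_lt_card (Finset.ssubset_iff_of_subset (fun p hp => ?_) |>.2
      ⟨(i₀, j₀), by simpa using h₀, by simpa using (hmoved i₀ j₀).resolve_right (not_not.2 h₀U)⟩)
    simp only [Finset.mem_filter, Finset.mem_univ, true_and] at hp ⊢
    rwa [← moved_of_notMem (φ := φ) (x := x) ((hmoved p.1 p.2).resolve_left hp)]
  · rcases hmoved i j with h | h
    · exact hWD h
    · exact moved_of_notMem (φ := φ) h ▸ hxD i j

end Kernel

section Codes

variable {V : Type*} [DecidableEq V] (G : SimpleGraph V) [DecidableRel G.Adj]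

/-- The number whose base-4 expansion is `1` followed by the digits in `l`; the leading `1` keeps
the length of `l` recoverable. -/
def encode (l : List ℕ) : ℕ := Nat.ofDigits 4 (l.reverse ++ [1])

/-- Adjacency and equality of two vertices as a base-4 digit. -/
def pairDigit (a b : V) : ℕ := 2 * (if G.Adj a b then 1 else 0) + (if a = b then 1 else 0)

/-- The isomorphism type of a list of vertices, as a number. -/
def listCode (l : List V) : ℕ := encode (l.flatMap fun a => l.map (pairDigit G a))

theorem encode_nil : encode [] = 1 := by simp [encode]

theorem encode_append_singleton (l : List ℕ) (d : ℕ) : encode (l ++ [d]) = 4 * encode l + d := by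
  simp [encode, Nat.ofDigits_cons, add_comm]

theorem encode_injective {l l' : List ℕ} (hl : ∀ d ∈ l, d < 4) (hl' : ∀ d ∈ l', d < 4)
    (h : encode l = encode l') : l = l' := by
  have digits_encode {l : List ℕ} (hl : ∀ d ∈ l, d < 4) :
      Nat.digits 4 (encode l) = l.reverse ++ [1] :=
    Nat.digits_ofDigits 4 (by omega) _ (by simpa [or_imp, forall_and] using hl) (by simp)
  rw [← List.reverse_inj, ← List.append_left_inj [1], ← digits_encode hl, ← digits_encode hl', h]

theorem encode_lt {l : List ℕ} (hl : ∀ d ∈ l, d < 4) : encode l < 4 ^ (l.length + 1) :=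
  (Nat.ofDigits_lt_base_pow_length (by omega) (by simpa [or_imp, forall_and] using hl)).trans_eq
    (by simp)

variable {G}

theorem pairDigit_lt (a b : V) : pairDigit G a b < 4 := by
  unfold pairDigit; split_ifs <;> omega

theorem pairDigit_eq_pairDigit {a b a' b' : V} (h : pairDigit G a b = pairDigit G a' b') :
    (G.Adj a b ↔ G.Adj a' b') ∧ (a = b ↔ a' = b') := by
  unfold pairDigit at h
  split_ifs at h <;> simp_all

theorem lt_four_of_mem_flatMap_pairDigit {l : List V} :
    ∀ d ∈ l.flatMap (fun a => l.map (pairDigit G a)), d < 4 := by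
  simp only [List.mem_flatMap, List.mem_map]
  rintro d ⟨a, -, b, -, rfl⟩
  exact pairDigit_lt a b

theorem listCode_lt (l : List V) : listCode G l < 4 ^ (l.length * l.length + 1) :=
  (encode_lt lt_four_of_mem_flatMap_pairDigit).trans_eq (by simp [List.length_flatMap])

theorem length_eq_of_listCode_eq {l l' : List V} (h : listCode G l = listCode G l') :
    l.length = l'.length := by
  have := congrArg List.length (encode_injective lt_four_of_mem_flatMap_pairDigit
    lt_four_of_mem_flatMap_pairDigit h)
  simp only [List.length_flatMap, List.length_map, List.map_const', List.sum_replicate,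
    smul_eq_mul] at this
  exact Nat.mul_self_inj.1 this

theorem getElem_of_listCode_eq {l l' : List V} (h : listCode G l = listCode G l') {p q : ℕ}
    (hp : p < l.length) (hq : q < l.length) (hp' : p < l'.length) (hq' : q < l'.length) :
    (G.Adj l[p] l[q] ↔ G.Adj l'[p] l'[q]) ∧ (l[p] = l[q] ↔ l'[p] = l'[q]) := by
  have hdigits := encode_injective lt_four_of_mem_flatMap_pairDigit
    lt_four_of_mem_flatMap_pairDigit h
  rw [List.flatMap, List.flatMap] at hdigits
  have hrows := List.eq_iff_flatten_eq.2 ⟨hdigits, by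
    simp only [List.map_map, Function.comp_def, List.length_map, List.map_const',
      length_eq_of_listCode_eq h]⟩
  have hrow := List.getElem_of_eq hrows (i := p) (by simpa)
  simp only [List.getElem_map] at hrow
  have hdigit := List.getElem_of_eq hrow (i := q) (by simpa)
  simp only [List.getElem_map] at hdigit
  exact pairDigit_eq_pairDigit hdigit

theorem exists_map_eq_of_listCode_eq {l l' : List V} (h : listCode G l = listCode G l') :
    ∃ φ : V → V, l.map φ = l' ∧
      ∀ y ∈ l, ∀ z ∈ l, (G.Adj (φ y) (φ z) ↔ G.Adj y z) ∧ (φ y = φ z ↔ y = z) := by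
  have hlen := length_eq_of_listCode_eq h
  have hφ {p : ℕ} (hp : p < l.length) : l'.getD (l.idxOf l[p]) l[p] = l'[p] := by
    have hidx : l.idxOf l[p] < l.length := List.idxOf_lt_length_iff.2 (List.getElem_mem hp)
    rw [List.getD_eq_getElem _ _ (hlen ▸ hidx)]
    exact (getElem_of_listCode_eq h hidx hp _ _).2.1 (List.getElem_idxOf hidx)
  refine ⟨fun y => l'.getD (l.idxOf y) y, List.ext_getElem (by simpa using hlen)
    fun p hp _ => by simpa using hφ (by simpa using hp), fun y hy z hz => ?_⟩
  obtain ⟨p, hp, rfl⟩ := List.getElem_of_mem hy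
  obtain ⟨q, hq, rfl⟩ := List.getElem_of_mem hz
  simp only [hφ hp, hφ hq]
  have := getElem_of_listCode_eq h hp hq (hlen ▸ hp) (hlen ▸ hq)
  exact ⟨this.1.symm, this.2.symm⟩

theorem exists_isLocalIso_of_listCode_eq {A L L' : List V} {u v : V}
    (h : listCode G (A ++ u :: L) = listCode G (A ++ v :: L')) (hL : ∀ y, G.Adj u y → y ∈ L) :
    ∃ φ, IsLocalIso G A.toFinset u v φ := by
  obtain ⟨φ, hmap, hφ⟩ := exists_map_eq_of_listCode_eq h
  have hstar : ∀ y ∈ starSet G A.toFinset u, y ∈ A ++ u :: L := by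
    rintro y (hy | rfl | hy)
    · exact List.mem_append_left _ (List.mem_toFinset.1 hy)
    · simp
    · simp [hL y hy]
  rw [List.map_append, List.map_cons] at hmap
  obtain ⟨hA, hu⟩ := List.append_inj hmap (List.length_map _)
  exact ⟨φ, fun a ha => List.map_inj_left.1 (hA.trans A.map_id.symm) a (List.mem_toFinset.1 ha),
    (List.cons.inj hu).1,
    fun y hy z hz => (hφ y (hstar y hy) z (hstar z hz)).2.1,
    fun y hy z hz => (hφ y (hstar y hy) z (hstar z hz)).1⟩

end Codes

section Marking

variable (H : SimpleGraph ℕ) [DecidableRel H.Adj] (n : ℕ)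

/-- The neighbors of `v` among `0, …, n - 1`. -/
def nbrs (v : ℕ) : List ℕ := (List.range n).filter fun w => H.Adj v w

/-- The vertices of degree at least `M`. -/
def highs (M : ℕ) : List ℕ := (List.range n).filter fun v => M ≤ (nbrs H n v).length

/-- The list `A` followed by the closed neighborhood of `v`. -/
def starList (A : List ℕ) (v : ℕ) : List ℕ := A ++ v :: nbrs H n v

/-- The type of `v` over `A`: a number that determines the closed neighborhood of `v` up to
isomorphisms fixing `A`. -/
def starCode (A : List ℕ) (v : ℕ) : ℕ := listCode H (starList H n A v)

/-- The vertices in `S` of type `c`. -/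
def ofType (A : List ℕ) (S : Finset ℕ) (c : ℕ) : Finset ℕ := S.filter fun u => starCode H n A u = c

/-- The state of the marking process after the vertices `u < j`: the set `S` consists of such
vertices of degree less than `M`, at most `N` of each type over `A`, and it contains `N` vertices of
the type of every other such vertex. The list `W` contains `A` and the closed neighborhoods of the
vertices in `S`. -/
structure Marked (A : List ℕ) (M N j : ℕ) (S : Finset ℕ) (W : List ℕ) : Prop where
  low : ∀ u ∈ S, u < j ∧ (nbrs H n u).length < M
  card_le : ∀ c, (ofType H n A S c).card ≤ N
  full : ∀ u < j, (nbrs H n u).length < M → u ∉ S → N ≤ (ofType H n A S (starCode H n A u)).card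
  lt : ∀ y ∈ W, y < n
  high : ∀ a ∈ A, a ∈ W
  nbr : ∀ u ∈ S, ∀ y ∈ u :: nbrs H n u, y ∈ W
  length_le : W.length ≤ A.length + S.card * (A.length + M)

/-- An upper bound for the length of the list `W` of a marking process over at most `M` vertices. -/
def kernelBound (M N : ℕ) : ℕ := M + N * 4 ^ ((M + M) * (M + M) + 1) * (M + M)

variable {H n} {A : List ℕ} {M N j : ℕ} {S : Finset ℕ} {W : List ℕ}

theorem mem_nbrs {v w : ℕ} : w ∈ nbrs H n v ↔ w < n ∧ H.Adj v w := by simp [nbrs]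

theorem length_starList (A : List ℕ) (v : ℕ) :
    (starList H n A v).length = A.length + ((nbrs H n v).length + 1) := by
  rw [starList, List.length_append, List.length_cons]

theorem lt_of_mem_starList (hA : ∀ a ∈ A, a < n) (hj : j < n) {y : ℕ}
    (hy : y ∈ starList H n A j) : y < n := by
  rcases List.mem_append.1 hy with hy | hy
  · exact hA y hy
  · rcases List.mem_cons.1 hy with rfl | hy
    · exact hj
    · exact (mem_nbrs.1 hy).1

theorem ofType_insert (hj : j ∉ S) (c : ℕ) : (ofType H n A (insert j S) c).card =
    (ofType H n A S c).card + if starCode H n A j = c then 1 else 0 := by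
  rw [ofType, Finset.filter_insert]
  split_ifs
  · rw [Finset.card_insert_of_notMem (by simp [hj]), ofType]
  · rfl

theorem Marked.zero (hA : ∀ a ∈ A, a < n) : Marked H n A M N 0 ∅ A :=
  ⟨by simp, by simp [ofType], by simp, hA, fun _ h => h, by simp, by simp⟩

theorem Marked.skip (h : Marked H n A M N j S W)
    (hj : (nbrs H n j).length < M → N ≤ (ofType H n A S (starCode H n A j)).card) :
    Marked H n A M N (j + 1) S W :=
  { h with
    low := fun u hu => ⟨(h.low u hu).1.trans (Nat.lt_succ_self j), (h.low u hu).2⟩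
    full := fun u hu hlow hu' => (Nat.lt_succ_iff_lt_or_eq.1 hu).elim
      (fun hu => h.full u hu hlow hu') (fun hu => hu ▸ hj (hu ▸ hlow)) }

theorem Marked.notMem (h : Marked H n A M N j S W) : j ∉ S := fun hj => (h.low j hj).1.false

theorem Marked.insert (h : Marked H n A M N j S W) (hjn : j < n) (hlow : (nbrs H n j).length < M)
    (hA : ∀ a ∈ A, a < n) (hj : (ofType H n A S (starCode H n A j)).card < N) :
    Marked H n A M N (j + 1) (insert j S) (W ++ starList H n A j) where
  low u hu := by
    rcases Finset.mem_insert.1 hu with rfl | hu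
    · exact ⟨Nat.lt_succ_self _, hlow⟩
    · exact ⟨(h.low u hu).1.trans (Nat.lt_succ_self j), (h.low u hu).2⟩
  card_le c := by
    rw [ofType_insert h.notMem]
    split_ifs with hc
    · exact hc ▸ hj
    · exact h.card_le c
  full u hu hu' huS := by
    rw [Finset.mem_insert, not_or] at huS
    rw [ofType_insert h.notMem]
    exact (h.full u (by omega) hu' huS.2).trans (Nat.le_add_right _ _)
  lt y hy := (List.mem_append.1 hy).elim (h.lt y) (lt_of_mem_starList hA hjn)
  high a ha := List.mem_append_left _ (h.high a ha)
  nbr u hu y hy := by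
    rcases Finset.mem_insert.1 hu with rfl | hu
    · exact List.mem_append_right _ (List.mem_append_right _ hy)
    · exact List.mem_append_left _ (h.nbr u hu y hy)
  length_le := by
    have := h.length_le
    rw [Finset.card_insert_of_notMem h.notMem, List.length_append, length_starList, add_mul]
    omega

theorem Marked.card_le_mul (h : Marked H n A M N j S W) (hA : A.length ≤ M) :
    S.card ≤ N * 4 ^ ((M + M) * (M + M) + 1) := by
  refine Finset.card_le_mul_card_image_of_maps_to (f := starCode H n A)
    (t := Finset.range (4 ^ ((M + M) * (M + M) + 1))) (fun u hu => Finset.mem_range.2 ?_) N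
    (fun c _ => h.card_le c) |>.trans_eq (by rw [Finset.card_range])
  have hlen : (starList H n A u).length ≤ M + M := by
    have := (h.low u hu).2
    rw [length_starList]
    omega
  exact (listCode_lt _).trans_le (by gcongr; norm_num)

theorem Marked.length_le_kernelBound (h : Marked H n A M N j S W) (hA : A.length ≤ M) :
    W.length ≤ kernelBound M N :=
  h.length_le.trans (Nat.add_le_add hA (Nat.mul_le_mul (h.card_le_mul hA) (by omega)))

theorem Marked.exists_isColoringWitness_mem {ι : Type*} [Fintype ι] {R : ι → ι → Prop}
    {x : ι → ι → ℕ} (hH : ∀ v w, H.Adj v w → v < n ∧ w < n)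
    (h : Marked H n (highs H n M) M N n S W) (hM : 0 < M)
    (hN : Fintype.card ι * Fintype.card ι * (M * M) < N) (hx : IsColoringWitness H R x)
    (hxn : ∀ i j, x i j < n) : ∃ x', IsColoringWitness H R x' ∧ ∀ i j, x' i j ∈ W := by
  have hnbrs {v w : ℕ} : w ∈ nbrs H n v ↔ H.Adj v w :=
    mem_nbrs.trans (and_iff_right_of_imp fun h => (hH _ _ h).2)
  let _ : H.LocallyFinite := fun v => Fintype.ofFinset (nbrs H n v).toFinset fun w => by
    simp [hnbrs]
  have hnbrFinset (v : ℕ) : H.neighborFinset v = (nbrs H n v).toFinset := by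
    ext w; simp [hnbrs]
  have hdegree (v : ℕ) : H.degree v = (nbrs H n v).length := by
    rw [← SimpleGraph.card_neighborFinset_eq_degree, hnbrFinset]
    exact List.toFinset_card_of_nodup (List.nodup_range.filter _)
  have hlow (v : ℕ) (hv : v ∉ (highs H n M).toFinset) : (nbrs H n v).length < M := by
    by_cases hvn : v < n
    · simpa [highs, hvn] using hv
    · rw [List.eq_nil_iff_forall_not_mem.2 fun y hy => hvn (hH _ _ (hnbrs.1 hy)).1]
      exact hM
  have htypes (u : ℕ) (hu : u < n) (huA : u ∉ (highs H n M).toFinset) (huS : u ∉ S) : ∃ F ⊆ S,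
      Fintype.card ι * Fintype.card ι * (M * M) < F.card ∧
        ∀ w ∈ F, ∃ φ, IsLocalIso H (highs H n M).toFinset u w φ :=
    ⟨_, Finset.filter_subset _ _, hN.trans_le (h.full u hu (hlow u huA) huS), fun w hw =>
      exists_isLocalIso_of_listCode_eq (Finset.mem_filter.1 hw).2.symm fun _ => hnbrs.2⟩
  obtain ⟨x', hx', hx'W⟩ := hx.exists_forall_mem (W := W.toFinset) (D := Finset.range n)
    (by simpa using hxn) (fun v hv => hdegree v ▸ hlow v hv) (by simpa using htypes)
    (fun v hv => by simpa using h.lt v (by simpa using hv))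
    (fun v hv => List.mem_toFinset.2 (h.high v (List.mem_toFinset.1 hv)))
    fun u hu y hy => by simpa using h.nbr u hu y (by simpa [hnbrFinset] using hy)
  exact ⟨x', hx', fun i j => List.mem_toFinset.1 (hx'W i j)⟩

end Marking

section Lists

/-- The list of the first `c` values of `f`. -/
def listOf {α : Type*} (f : ℕ → α) (c : ℕ) : List α := (List.range c).map f

variable {α : Type*} {f : ℕ → α} {c : ℕ}

@[simp] theorem listOf_zero (f : ℕ → α) : listOf f 0 = [] := rfl

@[simp] theorem length_listOf (f : ℕ → α) (c : ℕ) : (listOf f c).length = c := by simp [listOf]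

theorem mem_listOf {a : α} : a ∈ listOf f c ↔ ∃ i < c, f i = a := by simp [listOf]

theorem listOf_succ (f : ℕ → α) (c : ℕ) : listOf f (c + 1) = listOf f c ++ [f c] := by
  simp [listOf, List.range_succ]

theorem listOf_update (f : ℕ → α) (c : ℕ) (a : α) :
    listOf (Function.update f c a) (c + 1) = listOf f c ++ [a] := by
  rw [listOf_succ, Function.update_self]
  exact congrArg (· ++ _) (List.map_congr_left fun i hi =>
    Function.update_of_ne (List.mem_range.1 hi).ne _ _)

theorem take_listOf {d : ℕ} (h : d ≤ c) (f : ℕ → α) : (listOf f c).take d = listOf f d := by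
  rw [listOf, ← List.map_take, List.take_range, min_eq_left h, listOf]

theorem listOf_length_of_eq_append {l l' : List α} (h : listOf f c = l ++ l') :
    listOf f l.length = l := by
  have hc : l.length ≤ c := by
    rw [← length_listOf f c, h, List.length_append]
    exact Nat.le_add_right _ _
  rw [← take_listOf hc, h, List.take_left]

end Lists

section Candidates

/-- The entry of `f` selected by the digit of `c` in base `w` at position `i * k + j`. -/
def candidate {α : Type*} (f : ℕ → α) (w k c : ℕ) (i j : Fin k) : α :=
  f (c / w ^ (i * k + j : ℕ) % w)

variable {α : Type*} {f : ℕ → α} {w k c : ℕ}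

theorem candidate_mem_listOf (hc : c < w ^ (k * k)) (i j : Fin k) :
    candidate f w k c i j ∈ listOf f w := by
  have hk : k * k ≠ 0 := (Nat.mul_pos i.pos i.pos).ne'
  have hw : 0 < w := Nat.pos_of_ne_zero fun hw => by simp [hw, hk] at hc
  exact mem_listOf.2 ⟨_, Nat.mod_lt _ hw, rfl⟩

theorem exists_candidate_eq {x : Fin k → Fin k → α} (hx : ∀ i j, x i j ∈ listOf f w) :
    ∃ c < w ^ (k * k), candidate f w k c = x := by
  choose d hd hfd using fun i j => mem_listOf.1 (hx i j)
  let e : Fin (k * k) → Fin w := fun p => ⟨_, hd p.divNat p.modNat⟩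
  refine ⟨finFunctionFinEquiv e, (finFunctionFinEquiv e).2, funext₂ fun i j => ?_⟩
  have hdigit := congrFun (finFunctionFinEquiv.symm_apply_apply e) (finProdFinEquiv (i, j))
  have hpair : ((finProdFinEquiv (i, j)).divNat, (finProdFinEquiv (i, j)).modNat) = (i, j) :=
    finProdFinEquiv.symm_apply_apply (i, j)
  simp only [Prod.mk.injEq] at hpair
  simp only [e, hpair] at hdigit
  rw [candidate, ← hfd i j]
  refine congrArg f ((congrArg Fin.val hdigit).symm.trans ?_).symm
  simp [finFunctionFinEquiv, e, mul_comm, add_comm]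

end Candidates

section Transfer

variable {n : ℕ} (G : SimpleGraph (Fin n))

/-- The graph `G` as a graph on the natural numbers. -/
abbrev natGraph : SimpleGraph ℕ := G.map Fin.valEmbedding

variable {G}

theorem natGraph_adj {u v : ℕ} (hu : u < n) (hv : v < n) :
    (natGraph G).Adj u v ↔ G.Adj ⟨u, hu⟩ ⟨v, hv⟩ :=
  SimpleGraph.map_adj_apply (f := Fin.valEmbedding) (a := ⟨u, hu⟩) (b := ⟨v, hv⟩)

theorem lt_of_natGraph_adj {u v : ℕ} (h : (natGraph G).Adj u v) : u < n ∧ v < n := by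
  obtain ⟨a, b, -, rfl, rfl⟩ := (SimpleGraph.map_adj _ _ _ _).1 h
  exact ⟨a.2, b.2⟩

theorem exists_isColoringWitness_natGraph_iff {ι : Type*} {R : ι → ι → Prop} :
    (∃ x, IsColoringWitness (natGraph G) R x ∧ ∀ i j, x i j < n) ↔
      ∃ x, IsColoringWitness G R x :=
  ⟨fun ⟨x, hx, hxn⟩ => ⟨fun i j => ⟨x i j, hxn i j⟩,
      (isColoringWitness_map_iff Fin.valEmbedding).1 hx⟩,
    fun ⟨x, hx⟩ => ⟨_, (isColoringWitness_map_iff Fin.valEmbedding).2 hx, fun i j => (x i j).2⟩⟩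

theorem length_filter_range (n : ℕ) (p : ℕ → Prop) [DecidablePred p] :
    ((List.range n).filter (p ·)).length = (Finset.univ.filter fun i : Fin n => p i).card := by
  rw [← List.toFinset_card_of_nodup (List.nodup_range.filter _),
    ← Finset.card_map Fin.valEmbedding]
  congr 1
  ext i
  simp [Fin.exists_iff, and_comm]

variable [DecidableRel G.Adj] [DecidableRel (natGraph G).Adj]

theorem length_nbrs_natGraph (v : Fin n) : (nbrs (natGraph G) n v).length = G.degree v := by
  rw [nbrs, length_filter_range, ← G.card_neighborFinset_eq_degree]
  congr 1
  ext w
  simp [natGraph_adj v.2 w.2, -SimpleGraph.map_adj]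

theorem length_highs_natGraph (M : ℕ) :
    (highs (natGraph G) n M).length = (Finset.univ.filter fun v => M ≤ G.degree v).card := by
  simp only [highs, length_filter_range, length_nbrs_natGraph]

end Transfer

namespace RAM

/-- The registers that a program may write. -/
def Prog.regsOut : Prog → List ℕ
  | .skip => []
  | .assign x _ => [x]
  | .store _ _ _ => []
  | .seq p q => p.regsOut ++ q.regsOut
  | .branch _ p q => p.regsOut ++ q.regsOut
  | .loop _ p => p.regsOut

/-- The arrays that a program may write. -/
def Prog.arrsOut : Prog → List ℕ
  | .skip => []
  | .assign _ _ => []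
  | .store a _ _ => [a]
  | .seq p q => p.arrsOut ++ q.arrsOut
  | .branch _ p q => p.arrsOut ++ q.arrsOut
  | .loop _ p => p.arrsOut

/-- The states `s` and `s'` differ only in what the program `p` may write. -/
structure Frame (p : Prog) (s s' : State) : Prop where
  regs : ∀ x, x ∉ p.regsOut → s'.regs x = s.regs x
  arrs : ∀ a, a ∉ p.arrsOut → s'.arrs a = s.arrs a

section Rules

variable {p q : Prog} {s s₁ s₂ : State} {T T₁ T₂ : ℕ} {Q Q₁ : State → Prop} {i b N : ℕ}

theorem Frame.refl (p : Prog) (s : State) : Frame p s s := ⟨fun _ _ => rfl, fun _ _ => rfl⟩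

theorem Frame.trans (h₁ : Frame p s s₁) (h₂ : Frame p s₁ s₂) : Frame p s s₂ :=
  ⟨fun x hx => (h₂.regs x hx).trans (h₁.regs x hx), fun a ha => (h₂.arrs a ha).trans (h₁.arrs a ha)⟩

theorem Frame.mono (h : Frame p s s₁) (hregs : p.regsOut ⊆ q.regsOut)
    (harrs : p.arrsOut ⊆ q.arrsOut) : Frame q s s₁ :=
  ⟨fun x hx => h.regs x fun h => hx (hregs h), fun a ha => h.arrs a fun h => ha (harrs h)⟩

@[simp] theorem setReg_regs (s : State) (x v y : ℕ) :
    (s.setReg x v).regs y = if y = x then v else s.regs y := by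
  simp only [State.setReg, Function.update_apply]

@[simp] theorem setReg_arrs (s : State) (x v : ℕ) : (s.setReg x v).arrs = s.arrs := rfl

@[simp] theorem setArr_regs (s : State) (a i v : ℕ) : (s.setArr a i v).regs = s.regs := rfl

@[simp] theorem setArr_arrs (s : State) (a i v b : ℕ) :
    (s.setArr a i v).arrs b = if b = a then Function.update (s.arrs a) i v else s.arrs b := by
  simp only [State.setArr, Function.update_apply]

theorem Frame.setReg {x v : ℕ} (hx : x ∈ p.regsOut) : Frame p s (s.setReg x v) :=
  ⟨fun y hy => by rw [setReg_regs, if_neg (ne_of_mem_of_not_mem hx hy).symm], fun _ _ => rfl⟩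

theorem Frame.setArr {a c v : ℕ} (ha : a ∈ p.arrsOut) : Frame p s (s.setArr a c v) :=
  ⟨fun _ _ => rfl, fun b hb => by rw [setArr_arrs, if_neg (ne_of_mem_of_not_mem ha hb).symm]⟩

theorem Exec.frame (h : Exec p s s₁ T) : Frame p s s₁ := by
  induction h with
  | skip s => exact .refl _ s
  | assign s x e => exact .setReg (List.mem_singleton_self x)
  | store s a e₁ e₂ => exact .setArr (List.mem_singleton_self a)
  | seq _ _ ih₁ ih₂ =>
    exact (ih₁.mono (List.subset_append_left _ _) (List.subset_append_left _ _)).trans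
      (ih₂.mono (List.subset_append_right _ _) (List.subset_append_right _ _))
  | branchTrue _ _ ih => exact ih.mono (List.subset_append_left _ _) (List.subset_append_left _ _)
  | branchFalse _ _ ih =>
    exact ih.mono (List.subset_append_right _ _) (List.subset_append_right _ _)
  | loopTrue _ _ _ ih₁ ih₂ =>
    exact (Frame.mono (q := .loop _ _) ih₁ (List.Subset.refl _) (List.Subset.refl _)).trans ih₂
  | loopFalse _ => exact .refl _ _

/-- Started in state `s`, the program `p` halts within `T` steps in a state with property `Q`. -/
def Runs (p : Prog) (s : State) (T : ℕ) (Q : State → Prop) : Prop :=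
  ∃ (s' : State) (T' : ℕ), Exec p s s' T' ∧ T' ≤ T ∧ Q s'

theorem Runs.mono (h : Runs p s T₁ Q₁) (hT : T₁ ≤ T) (hQ : ∀ s', Q₁ s' → Frame p s s' → Q s') :
    Runs p s T Q := by
  obtain ⟨s', T', he, hT', hq⟩ := h
  exact ⟨s', T', he, hT'.trans hT, hQ s' hq he.frame⟩

theorem Runs.skip (hQ : Q s) (hT : 1 ≤ T) : Runs .skip s T Q :=
  ⟨s, 1, .skip s, hT, hQ⟩

theorem Runs.assign {x : ℕ} {e : Expr} (hQ : Q (s.setReg x (e.eval s))) (hT : e.cost + 1 ≤ T) :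
    Runs (.assign x e) s T Q :=
  ⟨_, _, .assign s x e, hT, hQ⟩

theorem Runs.store {a : ℕ} {e₁ e₂ : Expr} (hQ : Q (s.setArr a (e₁.eval s) (e₂.eval s)))
    (hT : e₁.cost + e₂.cost + 1 ≤ T) : Runs (.store a e₁ e₂) s T Q :=
  ⟨_, _, .store s a e₁ e₂, hT, hQ⟩

theorem Runs.seq (h₁ : Runs p s T₁ Q₁) (h₂ : ∀ s₁, Q₁ s₁ → Frame p s s₁ → Runs q s₁ T₂ Q)
    (hT : T₁ + T₂ ≤ T) : Runs (.seq p q) s T Q := by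
  obtain ⟨s₁, T₁', he₁, hT₁, hq₁⟩ := h₁
  obtain ⟨s₂, T₂', he₂, hT₂, hq₂⟩ := h₂ s₁ hq₁ he₁.frame
  exact ⟨s₂, _, .seq he₁ he₂, by omega, hq₂⟩

theorem Runs.assign_seq {x : ℕ} {e : Expr} (h : Runs q (s.setReg x (e.eval s)) T₂ Q)
    (hT : e.cost + 1 + T₂ ≤ T) : Runs (.seq (.assign x e) q) s T Q :=
  Runs.seq (Q₁ := fun s' => s' = s.setReg x (e.eval s)) (.assign rfl le_rfl)
    (fun _ h₁ _ => h₁ ▸ h) hT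

theorem Runs.store_seq {a : ℕ} {e₁ e₂ : Expr}
    (h : Runs q (s.setArr a (e₁.eval s) (e₂.eval s)) T₂ Q)
    (hT : e₁.cost + e₂.cost + 1 + T₂ ≤ T) : Runs (.seq (.store a e₁ e₂) q) s T Q :=
  Runs.seq (Q₁ := fun s' => s' = s.setArr a (e₁.eval s) (e₂.eval s)) (.store rfl le_rfl)
    (fun _ h₁ _ => h₁ ▸ h) hT

theorem Runs.branch {e : Expr} (hp : e.eval s ≠ 0 → Runs p s T₁ Q)
    (hq : e.eval s = 0 → Runs q s T₁ Q) (hT : e.cost + 1 + T₁ ≤ T) :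
    Runs (.branch e p q) s T Q := by
  by_cases h : e.eval s = 0
  · obtain ⟨s', T', he, hT', hQ⟩ := hq h
    exact ⟨s', _, .branchFalse h he, by omega, hQ⟩
  · obtain ⟨s', T', he, hT', hQ⟩ := hp h
    exact ⟨s', _, .branchTrue h he, by omega, hQ⟩

/-- The invariant `I j` speaks about the states in which at most `j` iterations are left. -/
theorem Runs.loop {e : Expr} (I : ℕ → State → Prop) (h₀ : I N s)
    (hpos : ∀ s₁, I 0 s₁ → e.eval s₁ = 0)
    (hstep : ∀ j s₁, I (j + 1) s₁ → e.eval s₁ ≠ 0 → Runs p s₁ T (I j)) :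
    Runs (.loop e p) s (N * (e.cost + 1 + T) + (e.cost + 1))
      (fun s' => e.eval s' = 0 ∧ ∃ j, I j s') := by
  induction N generalizing s with
  | zero => exact ⟨s, _, .loopFalse (hpos s h₀), by omega, hpos s h₀, 0, h₀⟩
  | succ N ih =>
    by_cases h : e.eval s = 0
    · exact ⟨s, _, .loopFalse h, by omega, h, _, h₀⟩
    · obtain ⟨s₁, T₁, he₁, hT₁, hI⟩ := hstep N s h₀ h
      obtain ⟨s₂, T₂, he₂, hT₂, hQ⟩ := ih hI
      exact ⟨s₂, _, .loopTrue h he₁ he₂, by rw [add_mul]; omega, hQ⟩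

/-- Execute `p` for `i = 0, …, b - 1`, where `i` and `b` are registers. -/
def Prog.forLoop (i b : ℕ) (p : Prog) : Prog :=
  .seq (.assign i (.const 0)) (.loop (.sub (.reg b) (.reg i))
    (.seq p (.assign i (.add (.reg i) (.const 1)))))

theorem Frame.setReg_forLoop {v : ℕ} (h : Frame (.forLoop i b p) s s₁) :
    Frame (.forLoop i b p) s (s₁.setReg i v) :=
  h.trans (.setReg List.mem_cons_self)

theorem Frame.forLoop (h : Frame p s s₁) : Frame (.forLoop i b p) s s₁ :=
  h.mono (fun _ hx => List.mem_append_right _ (List.mem_append_left _ hx))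
    (fun _ ha => List.mem_append_right _ (List.mem_append_left _ ha))

theorem Runs.forLoop (I : ℕ → State → Prop) (hi : i ∉ p.regsOut) (hb : b ∉ p.regsOut)
    (hbi : b ≠ i) (hN : s.regs b = N) (h₀ : I 0 (s.setReg i 0))
    (hstep : ∀ j < N, ∀ s₁, I j s₁ → s₁.regs i = j → Frame (.forLoop i b p) s s₁ →
      Runs p s₁ T (fun s₂ => I (j + 1) (s₂.setReg i (j + 1)))) :
    Runs (.forLoop i b p) s (N * (T + 8) + 6) (I N) := by
  have hb' {s₁ : State} (h : Frame (.forLoop i b p) s s₁) : s₁.regs b = N := by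
    rw [h.regs b (by simp [Prog.forLoop, Prog.regsOut, hb, hbi]), hN]
  refine Runs.assign_seq (T₂ := N * (T + 8) + 4) ((Runs.loop (N := N) (T := T + 4)
    (fun j s₁ => ∃ l, l + j = N ∧ s₁.regs i = l ∧ I l s₁ ∧ Frame (.forLoop i b p) s s₁)
    ⟨0, by simp, by simp, h₀, (Frame.refl _ s).setReg_forLoop⟩ ?_ ?_).mono ?_ ?_) ?_
  · rintro s₁ ⟨l, rfl, hl, -, hf⟩
    simp [Expr.eval, hb' hf, hl]
  · rintro j s₁ ⟨l, hl, hli, hI, hf⟩ -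
    refine Runs.seq (hstep l (by omega) s₁ hI hli hf) (T₂ := 4) (fun s₂ hI₂ hf₂ => ?_) le_rfl
    refine Runs.assign ⟨l + 1, by omega, ?_⟩ (by simp [Expr.cost])
    simp only [Expr.eval, hf₂.regs i hi, hli]
    exact ⟨by simp, hI₂, (hf.trans hf₂.forLoop).setReg_forLoop⟩
  · simp only [Expr.cost]
    exact le_of_eq (by ring)
  · rintro s' ⟨he, j, l, hl, hli, hI, hf⟩ -
    simp only [Expr.eval, hb' hf, hli] at he
    obtain rfl : l = N := by omega
    exact hI
  · simp only [Expr.cost]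
    omega

/-- Register `c` is zero at the end of the loop if it was zero at the beginning and every iteration
passed the test `C`. -/
theorem Runs.checkLoop {c : ℕ} (C : Fin N → Prop) (hi : i ∉ p.regsOut) (hb : b ∉ p.regsOut)
    (hbi : b ≠ i) (hci : c ≠ i) (hN : s.regs b = N)
    (hstep : ∀ (j : Fin N) (s₁ : State), s₁.regs i = j → Frame (.forLoop i b p) s s₁ →
      Runs p s₁ T (fun s₂ => s₂.regs c = 0 ↔ s₁.regs c = 0 ∧ C j)) :
    Runs (.forLoop i b p) s (N * (T + 8) + 6)
      (fun s' => s'.regs c = 0 ↔ s.regs c = 0 ∧ ∀ j, C j) := by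
  refine (Runs.forLoop (fun j s' => s'.regs c = 0 ↔ s.regs c = 0 ∧ ∀ l : Fin N, l < j → C l)
    hi hb hbi hN (by simp [hci]) fun j hj s₁ h₁ hji hf => ?_).mono le_rfl
      fun s' h _ => by simpa using h
  refine (hstep ⟨j, hj⟩ s₁ hji hf).mono le_rfl fun s₂ h₂ _ => ?_
  rw [setReg_regs, if_neg hci, h₂, h₁, and_assoc]
  refine and_congr_right fun _ => ⟨fun h l hl => ?_, fun h => ⟨fun l hl => h l (by omega),
    h ⟨j, hj⟩ (Nat.lt_succ_self j)⟩⟩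
  rcases Nat.lt_succ_iff_lt_or_eq.1 hl with hl | hl
  · exact h.1 l hl
  · obtain rfl : l = ⟨j, hj⟩ := Fin.ext hl
    exact h.2

end Rules

attribute [local simp] Expr.eval Expr.cost Prog.regsOut Prog.arrsOut

/-- Register `d` receives the product of the registers `a` and `b`, with `i` as counter. -/
def Prog.mul (d a b i : ℕ) : Prog :=
  .seq (.assign d (.const 0)) (.forLoop i b (.assign d (.add (.reg d) (.reg a))))

theorem Runs.mul {s : State} {d a b i : ℕ} (hda : a ≠ d) (hdb : b ≠ d) (hid : i ≠ d) (hia : a ≠ i)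
    (hib : b ≠ i) :
    Runs (.mul d a b i) s (s.regs b * 12 + 8) (fun s' => s'.regs d = s.regs a * s.regs b) := by
  refine Runs.assign_seq (T₂ := s.regs b * 12 + 6) ?_ (by simp; omega)
  refine Runs.forLoop (T := 4) (N := s.regs b) (fun j s' => s'.regs d = s.regs a * j ∧
    s'.regs a = s.regs a) (by simpa) (by simpa) hib (by simp [hdb])
    ?_ ?_ |>.mono le_rfl (fun s' h _ => h.1)
  · simp [hia, hid.symm, hda]
  · rintro j - s₁ ⟨h₁, h₂⟩ - -
    refine Runs.assign ?_ (by simp)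
    simp [hid.symm, h₁, h₂, hda, hia, mul_add]

/-- Divide register `r` by register `d`: register `q` receives the quotient and register `r` the
remainder. -/
def Prog.divMod (q r d : ℕ) : Prog :=
  .seq (.assign q (.const 0)) (.loop (.sub (.add (.reg r) (.const 1)) (.reg d))
    (.seq (.assign r (.sub (.reg r) (.reg d))) (.assign q (.add (.reg q) (.const 1)))))

theorem Runs.divMod {s : State} {q r d : ℕ} (hqr : q ≠ r) (hqd : d ≠ q) (hrd : d ≠ r)
    (hd : 0 < s.regs d) : Runs (.divMod q r d) s (s.regs r * 14 + 8)
      (fun s' => s'.regs q = s.regs r / s.regs d ∧ s'.regs r = s.regs r % s.regs d) := by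
  refine Runs.assign_seq (T₂ := s.regs r * 14 + 6) ((Runs.loop (T := 8) (N := s.regs r)
    (fun l s' => s'.regs r ≤ l ∧ s'.regs d = s.regs d ∧
      s'.regs r + s.regs d * s'.regs q = s.regs r)
    (by simp [hqr.symm, hqd]) (fun s₁ ⟨_, hd₁, _⟩ => ?_)
    fun l s₁ ⟨_, hd₁, _⟩ he => ?_).mono (by simp) fun s' ⟨he, l, _, hd', heq⟩ _ => ?_)
    (by simp; omega)
  · simp only [Expr.eval, hd₁]
    omega
  · simp only [Expr.eval, hd₁] at he
    refine Runs.assign_seq (T₂ := 4) (Runs.assign ?_ (by simp)) (by simp)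
    simp only [Expr.eval, setReg_regs, hqr, hqr.symm, hqd, hrd, hd₁, mul_add, if_true, if_false,
      true_and]
    omega
  · simp only [Expr.eval, hd'] at he
    have hlt : s'.regs r < s.regs d := by omega
    rw [← heq, Nat.add_mul_div_left _ _ hd, Nat.div_eq_of_lt hlt, Nat.add_mul_mod_self_left,
      Nat.mod_eq_of_lt hlt, zero_add]
    exact ⟨rfl, rfl⟩

/-- Cell `i` of array `a` receives `i` times the content of register `b`, for all `i` less than
that content; `i` and `c` are auxiliary registers. -/
def Prog.multiples (a b i c : ℕ) : Prog :=
  .seq (.assign c (.const 0)) (.forLoop i b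
    (.seq (.store a (.reg i) (.reg c)) (.assign c (.add (.reg c) (.reg b)))))

theorem Runs.multiples {s : State} {a b i c : ℕ} (hbc : b ≠ c) (hic : i ≠ c) (hbi : b ≠ i) :
    Runs (.multiples a b i c) s (s.regs b * 15 + 8)
      (fun s' => ∀ u < s.regs b, s'.arrs a u = u * s.regs b) := by
  refine Runs.assign_seq (T₂ := s.regs b * 15 + 6) ?_ (by simp; omega)
  refine Runs.forLoop (T := 7) (N := s.regs b) (fun j s' => s'.regs c = j * s.regs b ∧
    s'.regs b = s.regs b ∧ ∀ u < j, s'.arrs a u = u * s.regs b) (by simpa)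
    (by simpa) hbi (by simp [hbc]) ?_ ?_ |>.mono le_rfl (fun s' h _ => h.2.2)
  · simp [hbc, hic.symm, hbi]
  · rintro j - s₁ ⟨h₁, h₂, h₃⟩ hji -
    refine Runs.store_seq (T₂ := 4) (Runs.assign ⟨?_, ?_, fun u hu => ?_⟩ (by simp)) (by simp)
    · simp [hic.symm, h₁, h₂, add_mul]
    · simp [hbc, h₂, hbi]
    · simp only [Expr.eval, setReg_arrs, setArr_arrs, if_true, Function.update_apply, hji, h₁]
      split_ifs with h
      · rw [h]
      · exact h₃ u (by omega)

namespace Reg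

-- The first three registers hold the input.
abbrev order : ℕ := 0
abbrev colors : ℕ := 1
abbrev biclique : ℕ := 2
abbrev degreeBound : ℕ := 3
abbrev typeBound : ℕ := 4
abbrev pairs : ℕ := 5
abbrev highCount : ℕ := 6
abbrev kernelSize : ℕ := 7
abbrev vertex : ℕ := 8
abbrev length : ℕ := 9
abbrev index : ℕ := 10
abbrev code : ℕ := 11
abbrev row : ℕ := 12
abbrev col : ℕ := 13
abbrev row' : ℕ := 14
abbrev col' : ℕ := 15
abbrev defects : ℕ := 16
abbrev candidate : ℕ := 17
abbrev candidateCount : ℕ := 18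
abbrev digit : ℕ := 19
abbrev quotient : ℕ := 20
abbrev found : ℕ := 21
abbrev product : ℕ := 22
abbrev counter : ℕ := 23
abbrev rounds : ℕ := 24

end Reg

namespace Arr

-- The first array holds the input.
abbrev adj : ℕ := 0
abbrev rowStart : ℕ := 1
abbrev star : ℕ := 2
abbrev typeCount : ℕ := 3
abbrev kernel : ℕ := 4
abbrev colorStart : ℕ := 5
abbrev reps : ℕ := 6

end Arr

section Graph

/-- The graph `H` on the vertices `0, …, n - 1` is stored in the state `s`, together with the
positions at which the rows of its adjacency matrix start. -/
structure HoldsGraph (H : SimpleGraph ℕ) [DecidableRel H.Adj] (n : ℕ) (s : State) : Prop where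
  order : s.regs Reg.order = n
  row : ∀ u < n, s.arrs Arr.rowStart u = u * n
  entry : ∀ u < n, ∀ v < n, s.arrs Arr.adj (u * n + v) = if H.Adj u v then 1 else 0

/-- Adjacency of two vertices. -/
def Expr.adj (e₁ e₂ : Expr) : Expr := .load Arr.adj (.add (.load Arr.rowStart e₁) e₂)

/-- Equality of two numbers. -/
def Expr.eq (e₁ e₂ : Expr) : Expr := .sub (.const 1) (.add (.sub e₁ e₂) (.sub e₂ e₁))

variable {H : SimpleGraph ℕ} [DecidableRel H.Adj] {n : ℕ} {s : State}

theorem HoldsGraph.frame {s₁ s₂ : State} {p : Prog} (h : HoldsGraph H n s) (hf : Frame p s₁ s₂)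
    (hp : Reg.order ∉ p.regsOut ∧ Arr.adj ∉ p.arrsOut ∧ Arr.rowStart ∉ p.arrsOut := by decide)
    (hs : s₁.regs Reg.order = s.regs Reg.order ∧ s₁.arrs Arr.adj = s.arrs Arr.adj ∧
      s₁.arrs Arr.rowStart = s.arrs Arr.rowStart := by exact ⟨rfl, rfl, rfl⟩) :
    HoldsGraph H n s₂ := by
  have hsize : s₂.regs Reg.order = s.regs Reg.order := (hf.regs _ hp.1).trans hs.1
  have hadj : s₂.arrs Arr.adj = s.arrs Arr.adj := (hf.arrs _ hp.2.1).trans hs.2.1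
  have hrow : s₂.arrs Arr.rowStart = s.arrs Arr.rowStart := (hf.arrs _ hp.2.2).trans hs.2.2
  exact ⟨hsize ▸ h.order, hrow ▸ h.row, hadj ▸ h.entry⟩

theorem HoldsGraph.eval_adj (h : HoldsGraph H n s) {e₁ e₂ : Expr} {u v : ℕ} (hu : e₁.eval s = u)
    (hv : e₂.eval s = v) (hun : u < n) (hvn : v < n) :
    (Expr.adj e₁ e₂).eval s = if H.Adj u v then 1 else 0 := by
  rw [← h.entry _ hun _ hvn, ← h.row _ hun, ← hu, ← hv]
  rfl

@[simp] theorem eval_eq (s : State) (e₁ e₂ : Expr) :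
    (Expr.eq e₁ e₂).eval s = if e₁.eval s = e₂.eval s then 1 else 0 := by
  simp only [Expr.eq, Expr.eval]
  split_ifs <;> omega

@[simp] theorem cost_adj (e₁ e₂ : Expr) : (Expr.adj e₁ e₂).cost = e₁.cost + e₂.cost + 3 := by
  simp [Expr.adj]; omega

@[simp] theorem cost_eq (e₁ e₂ : Expr) :
    (Expr.eq e₁ e₂).cost = 2 * (e₁.cost + e₂.cost) + 5 := by
  simp [Expr.eq]; omega

/-- Register `length` receives the degree of the vertex in register `vertex`. -/
def Prog.degree : Prog :=
  .seq (.assign Reg.length (.const 0)) (.forLoop Reg.index Reg.order (.assign Reg.length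
    (.add (.reg Reg.length) (.adj (.reg Reg.vertex) (.reg Reg.index)))))

theorem Runs.degree (h : HoldsGraph H n s) (hv : s.regs Reg.vertex < n) :
    Runs .degree s (n * 16 + 8)
      (fun s' => s'.regs Reg.length = (nbrs H n (s.regs Reg.vertex)).length) := by
  refine Runs.assign_seq (T₂ := n * 16 + 6) ?_ (by simp; omega)
  refine Runs.forLoop (T := 8) (N := n) (fun j s' => s'.regs Reg.length =
    ((List.range j).filter fun w => H.Adj (s.regs Reg.vertex) w).length)
    (by decide) (by decide) (by decide) (by simp +decide [h.order]) (by simp +decide)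
    fun j hj s₁ hlen hj₁ hf => Runs.assign ?_ (by simp)
  have hv₁ : s₁.regs Reg.vertex = s.regs Reg.vertex := hf.regs _ (by decide)
  have hadj := (h.frame hf).eval_adj (e₁ := .reg _) (e₂ := .reg _) hv₁ hj₁ hv hj
  by_cases ha : H.Adj (s.regs Reg.vertex) j <;>
    simp +decide [List.range_succ, hlen, hadj, ha]

/-- The vertices of degree at least the content of register `degreeBound` are written into the
arrays `star` and `kernel`, their number into register `highCount`. -/
def Prog.collectHighs : Prog :=
  .seq (.assign Reg.highCount (.const 0)) (.forLoop Reg.vertex Reg.order (.seq .degree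
    (.branch (.sub (.reg Reg.degreeBound) (.reg Reg.length)) .skip
      (.seq (.store Arr.star (.reg Reg.highCount) (.reg Reg.vertex))
        (.seq (.store Arr.kernel (.reg Reg.highCount) (.reg Reg.vertex))
          (.assign Reg.highCount (.add (.reg Reg.highCount) (.const 1))))))))

theorem Runs.collectHighs (h : HoldsGraph H n s) :
    Runs .collectHighs s (n * (n * 16 + 30) + 8) (fun s' =>
      listOf (s'.arrs Arr.star) (s'.regs Reg.highCount) = highs H n (s.regs Reg.degreeBound) ∧
      listOf (s'.arrs Arr.kernel) (s'.regs Reg.highCount) =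
        highs H n (s.regs Reg.degreeBound)) := by
  refine Runs.assign_seq (T₂ := n * (n * 16 + 30) + 6) ?_ (by simp; omega)
  let l (j : ℕ) : List ℕ :=
    (List.range j).filter fun v => s.regs Reg.degreeBound ≤ (nbrs H n v).length
  refine Runs.forLoop (T := n * 16 + 22) (N := n) (fun j s' =>
    listOf (s'.arrs Arr.star) (s'.regs Reg.highCount) = l j ∧
    listOf (s'.arrs Arr.kernel) (s'.regs Reg.highCount) = l j)
    (by decide) (by decide) (by decide) (by simp +decide [h.order]) (by simp +decide [l])
    fun j hj s₁ ⟨hstar, hkernel⟩ hj₁ hf => ?_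
  refine Runs.seq (T₂ := 14) (Runs.degree (h.frame hf) (hj₁.trans_lt hj)) (fun s₂ hdeg hf₂ => ?_)
    (by omega)
  have hbound : s₂.regs Reg.degreeBound = s.regs Reg.degreeBound := by
    simp +decide [hf₂.regs, hf.regs]
  rw [hj₁] at hdeg
  refine Runs.branch (T₁ := 10) (fun he => Runs.skip ?_ (by omega)) (fun he => ?_) (by simp)
  · have hlow : ¬ s.regs Reg.degreeBound ≤ (nbrs H n j).length := by
      simp only [Expr.eval, hbound, hdeg] at he
      omega
    simpa +decide [l, List.range_succ, hlow, hf₂.regs, hf₂.arrs] using ⟨hstar, hkernel⟩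
  · have hhigh : s.regs Reg.degreeBound ≤ (nbrs H n j).length := by
      simp only [Expr.eval, hbound, hdeg] at he
      omega
    refine Runs.store_seq (T₂ := 7) (Runs.store_seq (T₂ := 4) (Runs.assign ?_ (by simp))
      (by simp)) (by simp)
    simpa +decide [l, List.range_succ, hhigh, hf₂.regs, hf₂.arrs, hj₁, listOf_update] using
      ⟨hstar, hkernel⟩

/-- The vertex in register `vertex` and its neighbors are appended to the list of length
`highCount` in array `star`; register `length` receives the new length. -/
def Prog.appendStar : Prog :=
  .seq (.store Arr.star (.reg Reg.highCount) (.reg Reg.vertex))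
    (.seq (.assign Reg.length (.add (.reg Reg.highCount) (.const 1)))
      (.forLoop Reg.index Reg.order (.branch (.adj (.reg Reg.vertex) (.reg Reg.index))
        (.seq (.store Arr.star (.reg Reg.length) (.reg Reg.index))
          (.assign Reg.length (.add (.reg Reg.length) (.const 1)))) .skip)))

theorem Runs.appendStar (h : HoldsGraph H n s) (hv : s.regs Reg.vertex < n) :
    Runs .appendStar s (n * 21 + 13) (fun s' => listOf (s'.arrs Arr.star) (s'.regs Reg.length) =
      starList H n (listOf (s.arrs Arr.star) (s.regs Reg.highCount)) (s.regs Reg.vertex)) := by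
  refine Runs.store_seq (T₂ := n * 21 + 10) (Runs.assign_seq (T₂ := n * 21 + 6) ?_
    (by simp; omega)) (by simp; omega)
  refine Runs.forLoop (T := 13) (N := n) (fun j s' => listOf (s'.arrs Arr.star)
    (s'.regs Reg.length) = listOf (s.arrs Arr.star) (s.regs Reg.highCount) ++
      s.regs Reg.vertex :: (List.range j).filter fun w => H.Adj (s.regs Reg.vertex) w)
    (by decide) (by decide) (by decide) (by simp +decide [h.order])
    (by simp +decide [listOf_update]) fun j hj s₁ hlist hj₁ hf => ?_
  have hv₁ : s₁.regs Reg.vertex = s.regs Reg.vertex := hf.regs _ (by decide)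
  have hadj := (h.frame hf).eval_adj (e₁ := .reg _) (e₂ := .reg _) hv₁ hj₁ hv hj
  refine Runs.branch (T₁ := 7) (fun he => ?_) (fun he => Runs.skip ?_ (by omega)) (by simp)
  · rw [hadj, ne_eq, ite_eq_right_iff, Classical.not_imp] at he
    refine Runs.store_seq (T₂ := 4) (Runs.assign ?_ (by simp)) (by simp)
    simp +decide [List.range_succ, he.1, hj₁, listOf_update, hlist]
  · rw [hadj, ite_eq_right_iff] at he
    simp +decide [List.range_succ, mt he, hlist]

/-- Register `code` receives the code of the list of length `length` in array `star`. -/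
def Prog.starCode : Prog :=
  .seq (.assign Reg.code (.const 1))
    (.forLoop Reg.row Reg.length (.forLoop Reg.col Reg.length (.assign Reg.code (.add
      (.add (.add (.reg Reg.code) (.reg Reg.code)) (.add (.reg Reg.code) (.reg Reg.code)))
      (.add (.add (.adj (.load Arr.star (.reg Reg.row)) (.load Arr.star (.reg Reg.col)))
          (.adj (.load Arr.star (.reg Reg.row)) (.load Arr.star (.reg Reg.col))))
        (.eq (.load Arr.star (.reg Reg.row)) (.load Arr.star (.reg Reg.col))))))))

theorem Runs.starCode (h : HoldsGraph H n s)
    (hlt : ∀ y ∈ listOf (s.arrs Arr.star) (s.regs Reg.length), y < n) :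
    Runs .starCode s (s.regs Reg.length * (s.regs Reg.length * 58 + 14) + 8) (fun s' =>
      s'.regs Reg.code = listCode H (listOf (s.arrs Arr.star) (s.regs Reg.length))) := by
  generalize hf : s.arrs Arr.star = f, hz : s.regs Reg.length = z at *
  let rows (p : ℕ) : List ℕ := (listOf f p).flatMap fun a => (listOf f z).map (pairDigit H a)
  have rows_succ (p : ℕ) : rows (p + 1) = rows p ++ (listOf f z).map (pairDigit H (f p)) := by
    simp [rows, listOf_succ]
  refine Runs.assign_seq (T₂ := z * (z * 58 + 14) + 6) ?_ (by simp; omega)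
  refine Runs.forLoop (T := z * 58 + 6) (N := z) (fun p s' => s'.regs Reg.code = encode (rows p))
    (by decide) (by decide) (by decide) (by simp +decide [hz])
    (by simp +decide [rows, encode_nil]) fun p hp s₁ hcode hp₁ hf₁ => ?_
  refine (Runs.forLoop (T := 50) (N := z) (fun q s' => s'.regs Reg.code =
    encode (rows p ++ (listOf f q).map (pairDigit H (f p))))
    (by decide) (by decide) (by decide) (by simp +decide [hf₁.regs, hz])
    (by simp +decide [hcode]) fun q hq s₂ hcode₂ hq₂ hf₂ => Runs.assign ?_ (by simp)).mono le_rfl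
    fun s' hs' _ => by simp +decide [hs', rows_succ]
  have hrow : (Expr.load Arr.star (.reg Reg.row)).eval s₂ = f p := by
    simp +decide [hf₂.regs, hf₂.arrs, hf₁.arrs, hp₁, hf]
  have hcol : (Expr.load Arr.star (.reg Reg.col)).eval s₂ = f q := by
    simp +decide [hf₂.arrs, hf₁.arrs, hq₂, hf]
  have hadj := ((h.frame hf₁).frame hf₂).eval_adj hrow hcol (hlt _ (mem_listOf.2 ⟨p, hp, rfl⟩))
    (hlt _ (mem_listOf.2 ⟨q, hq, rfl⟩))
  rw [listOf_succ, List.map_append, ← List.append_assoc, List.map_singleton,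
    encode_append_singleton, ← hcode₂, setReg_regs, if_neg (by decide), setReg_regs, if_pos rfl]
  simp only [Expr.eval, eval_eq] at hrow hcol hadj ⊢
  simp only [hadj, hrow, hcol, pairDigit]
  omega

/-- The list of length `length` in array `star` is appended to the list of length `kernelSize` in
array `kernel`. -/
def Prog.appendToKernel : Prog :=
  .forLoop Reg.index Reg.length
    (.seq (.store Arr.kernel (.reg Reg.kernelSize) (.load Arr.star (.reg Reg.index)))
      (.assign Reg.kernelSize (.add (.reg Reg.kernelSize) (.const 1))))

theorem Runs.appendToKernel (s : State) :
    Runs .appendToKernel s (s.regs Reg.length * 16 + 6) (fun s' =>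
      listOf (s'.arrs Arr.kernel) (s'.regs Reg.kernelSize) =
        listOf (s.arrs Arr.kernel) (s.regs Reg.kernelSize) ++
          listOf (s.arrs Arr.star) (s.regs Reg.length)) := by
  refine Runs.forLoop (T := 8) (N := s.regs Reg.length) (fun j s' =>
    listOf (s'.arrs Arr.kernel) (s'.regs Reg.kernelSize) =
      listOf (s.arrs Arr.kernel) (s.regs Reg.kernelSize) ++ listOf (s.arrs Arr.star) j)
    (by decide) (by decide) (by decide) rfl (by simp +decide) fun j _ s₁ hlist hj₁ hf =>
    Runs.store_seq (T₂ := 4) (Runs.assign ?_ (by simp)) (by simp)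
  simp +decide [listOf_succ (s.arrs Arr.star), hj₁, listOf_update, hlist, hf.arrs]

end Graph

section Marking

/-- The marking process has treated the vertices less than `j`: the list `A` is stored in array
`star`, the list of marked vertices together with their neighbors and `A` in array `kernel`, and the
numbers of marked vertices of each type in array `typeCount`. -/
structure HoldsMarked (H : SimpleGraph ℕ) [DecidableRel H.Adj] (n : ℕ) (A : List ℕ) (M N j : ℕ)
    (s : State) : Prop extends HoldsGraph H n s where
  highCount : s.regs Reg.highCount = A.length
  degreeBound : s.regs Reg.degreeBound = M
  typeBound : s.regs Reg.typeBound = N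
  star : listOf (s.arrs Arr.star) A.length = A
  marked : ∃ S, (∀ c, s.arrs Arr.typeCount c = (ofType H n A S c).card) ∧
    Marked H n A M N j S (listOf (s.arrs Arr.kernel) (s.regs Reg.kernelSize))

variable {H : SimpleGraph ℕ} [DecidableRel H.Adj] {n : ℕ} {s : State} {A : List ℕ} {M N j : ℕ}

theorem HoldsMarked.frame {s' : State} {p : Prog} (h : HoldsMarked H n A M N j s)
    (hf : Frame p s s') (hstar : listOf (s'.arrs Arr.star) A.length = A)
    (hp : (∀ x ∈ [Reg.order, Reg.highCount, Reg.degreeBound, Reg.typeBound, Reg.kernelSize],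
        x ∉ p.regsOut) ∧
      ∀ a ∈ [Arr.adj, Arr.rowStart, Arr.typeCount, Arr.kernel], a ∉ p.arrsOut := by decide) :
    HoldsMarked H n A M N j s' := by
  have hregs x hx : s'.regs x = s.regs x := hf.regs x (hp.1 x hx)
  have harrs a ha : s'.arrs a = s.arrs a := hf.arrs a (hp.2 a ha)
  refine ⟨h.toHoldsGraph.frame hf ⟨hp.1 _ ?_, hp.2 _ ?_, hp.2 _ ?_⟩, ?_, ?_, ?_, hstar, ?_⟩
  iterate 3 decide
  · rw [hregs _ (by decide), h.highCount]
  · rw [hregs _ (by decide), h.degreeBound]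
  · rw [hregs _ (by decide), h.typeBound]
  · rw [hregs _ (by decide), harrs _ (by decide), harrs _ (by decide)]
    exact h.marked

/-- Mark the vertex whose closed neighborhood is listed in array `star`, unless sufficiently many
vertices of the same type are marked. -/
def Prog.keep : Prog :=
  .seq .starCode (.branch (.sub (.reg Reg.typeBound) (.load Arr.typeCount (.reg Reg.code)))
    (.seq (.store Arr.typeCount (.reg Reg.code)
        (.add (.load Arr.typeCount (.reg Reg.code)) (.const 1)))
      .appendToKernel) .skip)

theorem Runs.keep (h : HoldsMarked H n A M N j s) (hA : ∀ a ∈ A, a < n) (hj : j < n)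
    (hlow : (nbrs H n j).length < M)
    (hstar : listOf (s.arrs Arr.star) (s.regs Reg.length) = starList H n A j) :
    Runs .keep s ((A.length + M) * ((A.length + M) * 58 + 30) + 30)
      (HoldsMarked H n A M N (j + 1)) := by
  have hlength : s.regs Reg.length ≤ A.length + M := by
    have := congrArg List.length hstar
    rw [length_listOf, length_starList] at this
    omega
  have hA' : listOf (s.arrs Arr.star) A.length = A := listOf_length_of_eq_append hstar
  refine Runs.seq (T₁ := (A.length + M) * ((A.length + M) * 58 + 14) + 8)
    (T₂ := (A.length + M) * 16 + 20) ((Runs.starCode h.toHoldsGraph fun y hy =>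
      lt_of_mem_starList hA hj (hstar ▸ hy)).mono (by gcongr) fun _ h _ => h)
    (fun s₁ hcode hf => ?_) (by linarith)
  rw [hstar] at hcode
  replace hcode : s₁.regs Reg.code = _root_.starCode H n A j := hcode
  have h₁ : HoldsMarked H n A M N j s₁ := h.frame hf (by rwa [hf.arrs _ (by decide)])
  obtain ⟨S, hcount, hS⟩ := h₁.marked
  refine Runs.branch (T₁ := (A.length + M) * 16 + 14) (fun he => ?_)
    (fun he => Runs.skip ?_ (by omega)) (by simp; omega)
  · simp only [Expr.eval, h₁.typeBound, hcode, hcount] at he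
    refine Runs.store_seq (T₂ := (A.length + M) * 16 + 6) ((Runs.appendToKernel _).mono ?_
      fun s₂ hkernel hf₂ => ?_) (by simp; omega)
    · simp +decide only [setArr_regs, hf.regs]
      omega
    replace hkernel : listOf (s₂.arrs Arr.kernel) (s₂.regs Reg.kernelSize) =
        listOf (s.arrs Arr.kernel) (s.regs Reg.kernelSize) ++ starList H n A j := by
      simpa +decide [hf.regs, hf.arrs, hstar] using hkernel
    refine ⟨h₁.toHoldsGraph.frame hf₂, ?_, ?_, ?_, ?_, insert j S, fun c => ?_, hkernel ▸ ?_⟩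
    · simp +decide [hf₂.regs, h₁.highCount]
    · simp +decide [hf₂.regs, h₁.degreeBound]
    · simp +decide [hf₂.regs, h₁.typeBound]
    · simp +decide [hf₂.arrs, h₁.star]
    · rw [ofType_insert hS.notMem]
      by_cases hc : c = s₁.regs Reg.code <;>
        simp +decide [hf₂.arrs, hcode ▸ hc, hcode, hcount, eq_comm (b := c)]
    · simpa +decide [hf.regs, hf.arrs] using hS.insert hj hlow hA (by omega)
  · simp only [Expr.eval, h₁.typeBound, hcode, hcount] at he
    exact { h₁ with marked := ⟨S, hcount, hS.skip fun _ => by omega⟩ }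

/-- Treat the vertex in register `vertex`. -/
def Prog.markVertex : Prog :=
  .seq .appendStar (.branch (.sub (.add (.add (.reg Reg.degreeBound) (.reg Reg.highCount))
    (.const 1)) (.reg Reg.length)) .keep .skip)

theorem Runs.markVertex (h : HoldsMarked H n A M N j s) (hA : ∀ a ∈ A, a < n) (hj : j < n)
    (hvertex : s.regs Reg.vertex = j) :
    Runs .markVertex s (n * 21 + (A.length + M) * ((A.length + M) * 58 + 30) + 51)
      (HoldsMarked H n A M N (j + 1)) := by
  refine Runs.seq (T₂ := (A.length + M) * ((A.length + M) * 58 + 30) + 38)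
    (Runs.appendStar h.toHoldsGraph (hvertex ▸ hj)) (fun s₁ hlist hf => ?_) (by omega)
  rw [h.highCount, h.star, hvertex] at hlist
  have h₁ : HoldsMarked H n A M N j s₁ := h.frame hf (listOf_length_of_eq_append hlist)
  have hlength : s₁.regs Reg.length = A.length + ((nbrs H n j).length + 1) := by
    rw [← length_starList, ← hlist, length_listOf]
  refine Runs.branch (T₁ := (A.length + M) * ((A.length + M) * 58 + 30) + 30)
    (fun he => ?_) (fun he => Runs.skip ?_ (by omega)) (by simp; omega)
  · simp only [Expr.eval, h₁.degreeBound, h₁.highCount, hlength] at he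
    exact Runs.keep h₁ hA hj (by omega) hlist
  · simp only [Expr.eval, h₁.degreeBound, h₁.highCount, hlength] at he
    obtain ⟨S, hcount, hS⟩ := h₁.marked
    exact { h₁ with marked := ⟨S, hcount, hS.skip fun _ => by omega⟩ }

/-- Starting from the list of high-degree vertices in the arrays `star` and `kernel`, treat all
vertices. -/
def Prog.mark : Prog :=
  .seq (.assign Reg.kernelSize (.reg Reg.highCount)) (.forLoop Reg.vertex Reg.order .markVertex)

/-- A bound on the running time of `Prog.mark` if there are `a` high-degree vertices. -/
def markTime (n a M : ℕ) : ℕ := n * (n * 21 + (a + M) * ((a + M) * 58 + 30) + 59) + 8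

theorem Runs.mark (h : HoldsGraph H n s) (hA : ∀ a ∈ A, a < n)
    (hstar : listOf (s.arrs Arr.star) (s.regs Reg.highCount) = A)
    (hkernel : listOf (s.arrs Arr.kernel) (s.regs Reg.highCount) = A)
    (hcount : s.arrs Arr.typeCount = 0) :
    Runs .mark s (markTime n A.length (s.regs Reg.degreeBound))
      (HoldsMarked H n A (s.regs Reg.degreeBound) (s.regs Reg.typeBound) n) := by
  have hhighCount : s.regs Reg.highCount = A.length := by rw [← hstar, length_listOf]
  refine Runs.assign_seq (T₂ := markTime n A.length (s.regs Reg.degreeBound) - 2) ?_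
    (by simp [markTime]; omega)
  refine (Runs.forLoop (N := n) (HoldsMarked H n A (s.regs Reg.degreeBound) (s.regs Reg.typeBound))
    (by decide) (by decide) (by decide) (by simp +decide [h.order]) ?_
    fun j hj s₁ h₁ hj₁ _ => (Runs.markVertex h₁ hA hj hj₁).mono le_rfl fun s₂ h₂ _ => ?_).mono
      le_rfl fun _ h _ => h
  · refine ⟨h.frame (Frame.refl .skip _), ?_, ?_, ?_, ?_, ∅, ?_, ?_⟩
    · simpa +decide using hhighCount
    · simp +decide
    · simp +decide
    · simpa [hhighCount] using hstar
    · simp [hcount, ofType]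
    · simpa +decide [hkernel] using Marked.zero hA
  · exact h₂.frame (Frame.setReg (p := .assign Reg.vertex (.const 0)) (by decide)) h₂.star

end Marking

section Arithmetic

variable {s : State}

/-- Register `degreeBound` receives the degree threshold, and register `typeBound` its fourth
power. -/
def Prog.thresholds : Prog :=
  .seq (.assign Reg.degreeBound (.add (.add (.reg Reg.pairs) (.reg Reg.colors))
      (.add (.reg Reg.biclique) (.const 2))))
    (.seq (.assign Reg.rounds (.add (.reg Reg.pairs) (.const 1)))
      (.seq (.forLoop Reg.index Reg.rounds
          (.seq (.mul Reg.product Reg.degreeBound Reg.degreeBound Reg.counter)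
            (.assign Reg.degreeBound (.reg Reg.product))))
        (.seq (.mul Reg.product Reg.degreeBound Reg.degreeBound Reg.counter)
          (.mul Reg.typeBound Reg.product Reg.product Reg.counter))))

/-- A bound on the running time of `Prog.thresholds` for `k` colors and degree threshold `M`. -/
def thresholdsTime (k M : ℕ) : ℕ := (k * k + 1) * (M * 12 + 18) + M * 12 + M * M * 12 + 34

theorem Runs.thresholds {k t : ℕ} (hcolors : s.regs Reg.colors = k)
    (hbiclique : s.regs Reg.biclique = t) (hpairs : s.regs Reg.pairs = k * k) :
    Runs .thresholds s (thresholdsTime k (degreeThreshold k t)) (fun s' =>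
      s'.regs Reg.degreeBound = degreeThreshold k t ∧
      s'.regs Reg.typeBound = degreeThreshold k t * degreeThreshold k t *
        (degreeThreshold k t * degreeThreshold k t)) := by
  set M := degreeThreshold k t
  refine Runs.assign_seq (T₂ := thresholdsTime k M - 8) (Runs.assign_seq
    (T₂ := thresholdsTime k M - 12) ?_ (by simp [thresholdsTime]; omega))
    (by simp [thresholdsTime]; omega)
  refine Runs.seq (T₁ := (k * k + 1) * (M * 12 + 18) + 6) (Runs.forLoop (N := k * k + 1)
    (fun j s' => s'.regs Reg.degreeBound = (k * k + k + t + 2) ^ 2 ^ j) (by decide) (by decide)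
    (by decide) (by simp +decide [hpairs])
    (by simp +decide [hpairs, hcolors, hbiclique, add_assoc]) fun j hj s₁ h₁ _ _ => ?_)
    (T₂ := M * 12 + M * M * 12 + 16) (fun s₁ h₁ _ => ?_) (by rw [thresholdsTime]; omega)
  · have hle : s₁.regs Reg.degreeBound ≤ M :=
      h₁.trans_le (Nat.pow_le_pow_right (by omega) (Nat.pow_le_pow_right (by omega) hj.le))
    refine Runs.seq (T₂ := 2) (Runs.mul (by decide) (by decide) (by decide) (by decide)
      (by decide)) (fun s₂ h₂ _ => Runs.assign ?_ (by simp)) (by omega)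
    simp +decide [h₂, h₁, pow_succ, pow_mul]
  · replace h₁ : s₁.regs Reg.degreeBound = M := h₁
    refine Runs.seq (T₂ := M * M * 12 + 8) (Runs.mul (by decide) (by decide) (by decide)
      (by decide) (by decide)) (fun s₂ h₂ hf₂ => (Runs.mul (by decide) (by decide) (by decide)
      (by decide) (by decide)).mono (by rw [h₂, h₁]) fun s₃ h₃ hf₃ => ?_) (by rw [h₁]; omega)
    simp +decide [hf₃.regs, hf₂.regs, h₁, h₂, h₃]

/-- Register `candidateCount` receives the power of register `kernelSize` to register `pairs`. -/
def Prog.power : Prog :=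
  .seq (.assign Reg.candidateCount (.const 1)) (.forLoop Reg.index Reg.pairs
    (.seq (.mul Reg.product Reg.candidateCount Reg.kernelSize Reg.counter)
      (.assign Reg.candidateCount (.reg Reg.product))))

theorem Runs.power (s : State) :
    Runs .power s (s.regs Reg.pairs * (s.regs Reg.kernelSize * 12 + 18) + 8) (fun s' =>
      s'.regs Reg.candidateCount = s.regs Reg.kernelSize ^ s.regs Reg.pairs) := by
  refine Runs.assign_seq (T₂ := s.regs Reg.pairs * (s.regs Reg.kernelSize * 12 + 18) + 6) ?_
    (by simp; omega)
  refine Runs.forLoop (T := s.regs Reg.kernelSize * 12 + 10) (N := s.regs Reg.pairs)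
    (fun j s' => s'.regs Reg.candidateCount = s.regs Reg.kernelSize ^ j)
    (by decide) (by decide) (by decide) rfl (by simp +decide) fun j _ s₁ h₁ _ hf => ?_
  have hsize : s₁.regs Reg.kernelSize = s.regs Reg.kernelSize := hf.regs _ (by decide)
  refine Runs.seq (T₂ := 2) (Runs.mul (by decide) (by decide) (by decide) (by decide)
    (by decide)) (fun s₂ h₂ _ => Runs.assign ?_ (by simp)) (by omega)
  simp +decide [h₂, h₁, hsize, pow_succ]

/-- The entries of array `kernel` selected by the digits of register `candidate` in base
`kernelSize` are written into array `reps`. -/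
def Prog.decode : Prog :=
  .seq (.assign Reg.digit (.reg Reg.candidate)) (.forLoop Reg.index Reg.pairs
    (.seq (.divMod Reg.quotient Reg.digit Reg.kernelSize)
      (.seq (.store Arr.reps (.reg Reg.index) (.load Arr.kernel (.reg Reg.digit)))
        (.assign Reg.digit (.reg Reg.quotient)))))

theorem Runs.decode {c w m : ℕ} (hc : s.regs Reg.candidate = c) (hw : s.regs Reg.kernelSize = w)
    (hm : s.regs Reg.pairs = m) (hlt : c < w ^ m) :
    Runs .decode s (m * (w ^ m * 14 + 22) + 8)
      (fun s' => ∀ p < m, s'.arrs Arr.reps p = s.arrs Arr.kernel (c / w ^ p % w)) := by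
  refine Runs.assign_seq (T₂ := m * (w ^ m * 14 + 22) + 6) ?_ (by simp; omega)
  refine Runs.mono (Runs.forLoop (T := w ^ m * 14 + 14) (N := m)
    (fun j s' => s'.regs Reg.digit = c / w ^ j ∧
      ∀ p < j, s'.arrs Arr.reps p = s.arrs Arr.kernel (c / w ^ p % w))
    (by decide) (by decide) (by decide) (by simp +decide [hm]) (by simp +decide [hc])
    fun j hj s₁ ⟨hdigit, hreps⟩ hj₁ hf => ?_) le_rfl fun s' h _ => h.2
  have hsize : s₁.regs Reg.kernelSize = w := (hf.regs _ (by decide)).trans hw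
  have hw₀ : 0 < w := Nat.pos_of_ne_zero fun hw₀ => by
    simp [hw₀, (Nat.zero_lt_of_lt hj).ne'] at hlt
  have hle : c / w ^ j ≤ w ^ m := (Nat.div_le_self _ _).trans hlt.le
  refine Runs.seq (T₂ := 6) (Runs.divMod (by decide) (by decide) (by decide) (hsize ▸ hw₀))
    (fun s₂ ⟨hquotient, hmod⟩ hf₂ => Runs.store_seq (T₂ := 2)
      (Runs.assign ⟨?_, fun p hp => ?_⟩ (by simp)) (by simp)) (by rw [hdigit]; omega)
  · simp +decide [hquotient, hdigit, hsize, Nat.div_div_eq_div_mul, pow_succ]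
  · rcases Nat.lt_succ_iff_lt_or_eq.1 hp with hp | rfl
    · simp +decide [hf₂.regs, hf₂.arrs, hj₁, Function.update_of_ne hp.ne, hreps p hp]
    · simp +decide [hf₂.regs, hf₂.arrs, hf.arrs, hj₁, hmod, hdigit, hsize]

end Arithmetic

section Check

/-- The family `x` is stored in array `reps`, together with the positions at which its rows
start. -/
structure HoldsReps (H : SimpleGraph ℕ) [DecidableRel H.Adj] (n : ℕ) {k : ℕ}
    (x : Fin k → Fin k → ℕ) (s : State) : Prop extends HoldsGraph H n s where
  colors : s.regs Reg.colors = k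
  colorStart : ∀ i : Fin k, s.arrs Arr.colorStart i = i * k
  reps : ∀ i j : Fin k, s.arrs Arr.reps (i * k + j) = x i j
  lt : ∀ i j, x i j < n

/-- The vertex stored for the pair of colors in the registers `a` and `b`. -/
def Expr.rep (a b : ℕ) : Expr :=
  .load Arr.reps (.add (.load Arr.colorStart (.reg a)) (.reg b))

@[simp] theorem cost_rep (a b : ℕ) : (Expr.rep a b).cost = 5 := rfl

variable {H : SimpleGraph ℕ} [DecidableRel H.Adj] {n k : ℕ} {s : State} {x : Fin k → Fin k → ℕ}

theorem HoldsReps.frame {s' : State} {p : Prog} (h : HoldsReps H n x s) (hf : Frame p s s')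
    (hp : (Reg.order ∉ p.regsOut ∧ Reg.colors ∉ p.regsOut) ∧
      ∀ a ∈ [Arr.adj, Arr.rowStart, Arr.colorStart, Arr.reps], a ∉ p.arrsOut := by decide) :
    HoldsReps H n x s' := by
  have harrs a ha : s'.arrs a = s.arrs a := hf.arrs a (hp.2 a ha)
  refine ⟨h.toHoldsGraph.frame hf ⟨hp.1.1, hp.2 _ ?_, hp.2 _ ?_⟩, ?_, ?_, ?_, h.lt⟩
  iterate 2 decide
  · rw [hf.regs _ hp.1.2, h.colors]
  · rw [harrs _ (by decide)]
    exact h.colorStart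
  · rw [harrs _ (by decide)]
    exact h.reps

theorem HoldsReps.eval_rep (h : HoldsReps H n x s) {a b : ℕ} {i j : Fin k} (hi : s.regs a = i)
    (hj : s.regs b = j) : (Expr.rep a b).eval s = x i j := by
  simp only [Expr.rep, Expr.eval, hi, hj, h.colorStart, h.reps]

theorem HoldsReps.eval_adj_rep (h : HoldsReps H n x s) {a b a' b' : ℕ} {i j i' j' : Fin k}
    (hi : s.regs a = i) (hj : s.regs b = j) (hi' : s.regs a' = i') (hj' : s.regs b' = j') :
    (Expr.adj (.rep a b) (.rep a' b')).eval s = if H.Adj (x i j) (x i' j') then 1 else 0 :=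
  h.eval_adj (h.eval_rep hi hj) (h.eval_rep hi' hj') (h.lt i j) (h.lt i' j')

/-- Increase register `defects` if the vertices stored for the pairs of colors in the registers
`row`, `col` and `row'`, `col'` are adjacent and have the same second color, or are equal and have
different second colors. -/
def Prog.checkPair : Prog :=
  .assign Reg.defects (.add (.reg Reg.defects) (.add
    (.sub (.add (.eq (.reg Reg.col) (.reg Reg.col'))
      (.adj (.rep Reg.row Reg.col) (.rep Reg.row' Reg.col'))) (.const 1))
    (.sub (.add (.sub (.const 1) (.eq (.reg Reg.col) (.reg Reg.col')))
      (.eq (.rep Reg.row Reg.col) (.rep Reg.row' Reg.col'))) (.const 1))))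

theorem Runs.checkPair (h : HoldsReps H n x s) {i j i' j' : Fin k} (hi : s.regs Reg.row = i)
    (hj : s.regs Reg.col = j) (hi' : s.regs Reg.row' = i') (hj' : s.regs Reg.col' = j') :
    Runs .checkPair s 72 (fun s' => s'.regs Reg.defects = 0 ↔ s.regs Reg.defects = 0 ∧
      (j = j' → ¬ H.Adj (x i j) (x i' j')) ∧ (j ≠ j' → x i j ≠ x i' j')) := by
  refine Runs.assign ?_ (by simp)
  simp only [setReg_regs, if_true, Expr.eval, eval_eq, h.eval_adj_rep hi hj hi' hj',
    h.eval_rep hi hj, h.eval_rep hi' hj', hj, hj', Fin.val_inj]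
  by_cases hadj : H.Adj (x i j) (x i' j') <;> by_cases heq : x i j = x i' j' <;>
    by_cases hjj' : j = j' <;> simp only [hadj, heq, hjj', if_true, if_false] <;> simp_all

/-- Compare the vertex stored for the pair of colors in the registers `row` and `col` with all
stored vertices. -/
def Prog.checkAgainst : Prog :=
  .forLoop Reg.row' Reg.colors (.forLoop Reg.col' Reg.colors .checkPair)

theorem Runs.checkAgainst (h : HoldsReps H n x s) {i j : Fin k} (hi : s.regs Reg.row = i)
    (hj : s.regs Reg.col = j) :
    Runs .checkAgainst s (k * (k * 80 + 14) + 6) (fun s' => s'.regs Reg.defects = 0 ↔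
      s.regs Reg.defects = 0 ∧ ∀ i' j' : Fin k,
        (j = j' → ¬ H.Adj (x i j) (x i' j')) ∧ (j ≠ j' → x i j ≠ x i' j')) :=
  Runs.checkLoop (T := k * 80 + 6) _ (by decide) (by decide) (by decide) (by decide) h.colors
    fun _ s₁ hi' hf => Runs.checkLoop _ (by decide) (by decide) (by decide) (by decide)
      (h.frame hf).colors fun _ s₂ hj' hf₂ => Runs.checkPair ((h.frame hf).frame hf₂)
        (by simp +decide [hf₂.regs, hf.regs, hi]) (by simp +decide [hf₂.regs, hf.regs, hj])
        (by simp +decide [hf₂.regs, hi']) hj'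

/-- Increase register `defects` if the expression `e` is nonzero, but the vertices stored for the
pairs of colors in the registers `row`, `row` and `row`, `col` are not adjacent. -/
def Prog.checkAdj (e : Expr) : Prog :=
  .assign Reg.defects (.add (.reg Reg.defects) (.sub (.add e
    (.sub (.const 1) (.adj (.rep Reg.row Reg.row) (.rep Reg.row Reg.col)))) (.const 1)))

/-- Increase register `defects` if the pair of colors in the registers `row` and `col` violates one
of the conditions on a witness. -/
def Prog.checkEntry (e : Expr) : Prog := .seq (.checkAdj e) .checkAgainst

@[simp] theorem regsOut_checkEntry (e : Expr) : (Prog.checkEntry e).regsOut =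
    [Reg.defects, Reg.row', Reg.col', Reg.defects, Reg.col', Reg.row'] := rfl

@[simp] theorem arrsOut_checkEntry (e : Expr) : (Prog.checkEntry e).arrsOut = [] := rfl

/-- Register `defects` receives `0` if and only if the stored vertices form a witness; the
expression `e` tells whether the color in register `row` has to see the color in register `col`. -/
def Prog.check (e : Expr) : Prog :=
  .seq (.assign Reg.defects (.const 0)) (.forLoop Reg.row Reg.colors (.forLoop Reg.col Reg.colors
    (.checkEntry e)))

@[simp] theorem regsOut_check (e : Expr) : (Prog.check e).regsOut =
    [Reg.defects, Reg.row, Reg.col, Reg.defects, Reg.row', Reg.col', Reg.defects, Reg.col',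
      Reg.row', Reg.col, Reg.row] := rfl

/-- A bound on the running time of `Prog.check` for `k` colors. -/
def checkTime (k : ℕ) : ℕ := k * (k * (k * (k * 80 + 14) + 56) + 14) + 8

variable {e : Expr} {R : ℕ → ℕ → Prop} [DecidableRel R]

theorem Runs.checkAdj (he : ∀ s, e.eval s = if R (s.regs Reg.row) (s.regs Reg.col) then 1 else 0)
    (hcost : e.cost ≤ 20) (h : HoldsReps H n x s) {i j : Fin k} (hi : s.regs Reg.row = i)
    (hj : s.regs Reg.col = j) :
    Runs (.checkAdj e) s 42 (fun s' => s'.regs Reg.defects = 0 ↔ s.regs Reg.defects = 0 ∧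
      (R i j → H.Adj (x i i) (x i j))) := by
  refine Runs.assign ?_ (by simp; omega)
  simp only [setReg_regs, if_true, Expr.eval, he, h.eval_adj_rep hi hi hi hj, hi, hj]
  by_cases hadj : H.Adj (x i i) (x i j) <;> by_cases hR : R i j <;> simp [hadj, hR]

/-- The part of the definition of a witness that `Prog.check` tests for the pair `(i, j)`. -/
def PassesCheck (H : SimpleGraph ℕ) (R : ℕ → ℕ → Prop) (x : Fin k → Fin k → ℕ) (i j : Fin k) :
    Prop :=
  (R i j → H.Adj (x i i) (x i j)) ∧ ∀ i' j' : Fin k,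
    (j = j' → ¬ H.Adj (x i j) (x i' j')) ∧ (j ≠ j' → x i j ≠ x i' j')

theorem forall_passesCheck_iff {H : SimpleGraph ℕ} {R : ℕ → ℕ → Prop} {x : Fin k → Fin k → ℕ} :
    (∀ i j, PassesCheck H R x i j) ↔ IsColoringWitness H (fun i j : Fin k => R i j) x := by
  refine ⟨fun h => ⟨fun i j => (h i j).1, fun i i' j => ((h i j).2 i' j).1 rfl,
    fun i i' j j' => ((h i j).2 i' j').2⟩,
    fun h i j => ⟨h.adj i j, fun i' j' => ⟨?_, h.ne i i' j j'⟩⟩⟩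
  rintro rfl
  exact h.not_adj i i' j

theorem Runs.checkEntry
    (he : ∀ s, e.eval s = if R (s.regs Reg.row) (s.regs Reg.col) then 1 else 0)
    (hcost : e.cost ≤ 20) (h : HoldsReps H n x s) {i j : Fin k} (hi : s.regs Reg.row = i)
    (hj : s.regs Reg.col = j) :
    Runs (.checkEntry e) s (k * (k * 80 + 14) + 48) (fun s' =>
      s'.regs Reg.defects = 0 ↔ s.regs Reg.defects = 0 ∧ PassesCheck H R x i j) := by
  refine Runs.seq (Runs.checkAdj he hcost h hi hj) (T₂ := k * (k * 80 + 14) + 6)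
    (fun s₁ h₁ hf => ?_) (by omega)
  have hrow : s₁.regs Reg.row = i := (hf.regs _ (by simp [Prog.checkAdj])).trans hi
  have hcol : s₁.regs Reg.col = j := (hf.regs _ (by simp [Prog.checkAdj])).trans hj
  refine (Runs.checkAgainst (h.frame hf (by simp [Prog.checkAdj])) hrow hcol).mono le_rfl
    fun s₂ h₂ _ => ?_
  rw [h₂, h₁, and_assoc, PassesCheck]

theorem Runs.check (he : ∀ s, e.eval s = if R (s.regs Reg.row) (s.regs Reg.col) then 1 else 0)
    (hcost : e.cost ≤ 20) (h : HoldsReps H n x s) :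
    Runs (.check e) s (checkTime k) (fun s' => s'.regs Reg.defects = 0 ↔
      IsColoringWitness H (fun i j : Fin k => R i j) x) := by
  have h₀ : HoldsReps H n x (s.setReg Reg.defects 0) :=
    h.frame (.setReg (p := .assign Reg.defects (.const 0)) (by decide))
  refine Runs.assign_seq (T₂ := k * (k * (k * (k * 80 + 14) + 56) + 14) + 6) (Runs.mono
    (Runs.checkLoop (c := Reg.defects) (T := k * (k * (k * 80 + 14) + 56) + 6)
      (fun i => ∀ j, PassesCheck H R x i j) (by simp [Prog.forLoop]) (by simp [Prog.forLoop])
      (by decide) (by decide) h₀.colors fun i s₁ hi hf => ?_)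
    le_rfl fun s' hs' _ => hs'.trans (by simp [forall_passesCheck_iff]))
    (by simp [checkTime]; omega)
  have h₁ : HoldsReps H n x s₁ := h₀.frame hf (by simp [Prog.forLoop])
  refine Runs.checkLoop (PassesCheck H R x i) (by simp) (by simp) (by decide) (by decide) h₁.colors
    fun j s₂ hj hf₂ => Runs.checkEntry he hcost (h₁.frame hf₂ (by simp [Prog.forLoop])) ?_ hj
  rw [hf₂.regs _ (by simp [Prog.forLoop]), hi]

end Check

section Search

/-- The graph `H` and the first `w` values of `f` are stored in the state `s`, together with the
number `k` of colors and the positions at which the rows of a `k × k` matrix start. -/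
structure HoldsKernel (H : SimpleGraph ℕ) [DecidableRel H.Adj] (n k w : ℕ) (f : ℕ → ℕ)
    (s : State) : Prop extends HoldsGraph H n s where
  colors : s.regs Reg.colors = k
  pairs : s.regs Reg.pairs = k * k
  kernelSize : s.regs Reg.kernelSize = w
  kernel : s.arrs Arr.kernel = f
  colorStart : ∀ i : Fin k, s.arrs Arr.colorStart i = i * k
  lt : ∀ v ∈ listOf f w, v < n

/-- If the vertices selected by register `candidate` form a witness, register `found` receives
`1`. -/
def Prog.testCandidate (e : Expr) : Prog :=
  .seq .decode (.seq (.check e) (.branch (.reg Reg.defects) .skip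
    (.assign Reg.found (.const 1))))

@[simp] theorem regsOut_testCandidate (e : Expr) : (Prog.testCandidate e).regsOut =
    Prog.decode.regsOut ++ ((Prog.check e).regsOut ++ [Reg.found]) := rfl

@[simp] theorem arrsOut_testCandidate (e : Expr) : (Prog.testCandidate e).arrsOut = [Arr.reps] :=
  rfl

variable {H : SimpleGraph ℕ} [DecidableRel H.Adj] {n k w : ℕ} {f : ℕ → ℕ} {s : State}
  {e : Expr} {R : ℕ → ℕ → Prop} [DecidableRel R]

theorem HoldsKernel.frame {s' : State} {p : Prog} (h : HoldsKernel H n k w f s)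
    (hf : Frame p s s')
    (hregs : ∀ x ∈ [Reg.order, Reg.colors, Reg.pairs, Reg.kernelSize], x ∉ p.regsOut)
    (harrs : ∀ a ∈ [Arr.adj, Arr.rowStart, Arr.colorStart, Arr.kernel], a ∉ p.arrsOut) :
    HoldsKernel H n k w f s' :=
  { h.toHoldsGraph.frame hf ⟨hregs _ (by decide), harrs _ (by decide), harrs _ (by decide)⟩ with
    colors := (hf.regs _ (hregs _ (by decide))).trans h.colors
    pairs := (hf.regs _ (hregs _ (by decide))).trans h.pairs
    kernelSize := (hf.regs _ (hregs _ (by decide))).trans h.kernelSize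
    kernel := (hf.arrs _ (harrs _ (by decide))).trans h.kernel
    colorStart := hf.arrs _ (harrs Arr.colorStart (by decide)) ▸ h.colorStart
    lt := h.lt }

theorem exists_candidate_iff {P : (Fin k → Fin k → ℕ) → Prop} :
    (∃ c < w ^ (k * k), P (candidate f w k c)) ↔ ∃ x, P x ∧ ∀ i j, x i j ∈ listOf f w := by
  constructor
  · rintro ⟨c, hc, hP⟩
    exact ⟨_, hP, candidate_mem_listOf hc⟩
  · rintro ⟨x, hP, hx⟩
    obtain ⟨c, hc, rfl⟩ := exists_candidate_eq hx
    exact ⟨c, hc, hP⟩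

open Classical in
theorem Runs.testCandidate
    (he : ∀ s, e.eval s = if R (s.regs Reg.row) (s.regs Reg.col) then 1 else 0)
    (hcost : e.cost ≤ 20) (h : HoldsKernel H n k w f s) {c : ℕ} (hc : s.regs Reg.candidate = c)
    (hlt : c < w ^ (k * k)) :
    Runs (.testCandidate e) s (k * k * (w ^ (k * k) * 14 + 22) + checkTime k + 12) (fun s' =>
      s'.regs Reg.found = if IsColoringWitness H (fun i j : Fin k => R i j) (candidate f w k c)
        then 1 else s.regs Reg.found) := by
  have hindex (i j : Fin k) : (i * k + j : ℕ) < k * k := by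
    nlinarith [Nat.mul_le_mul_right k (Nat.succ_le_of_lt i.2), j.2]
  refine Runs.seq (Runs.decode hc h.kernelSize h.pairs hlt) (T₂ := checkTime k + 4)
    (fun s₁ hdecode hf₁ => ?_) (by omega)
  have h₁ : HoldsReps H n (candidate f w k c) s₁ :=
    { h.toHoldsGraph.frame hf₁ with
      colors := (hf₁.regs _ (by decide)).trans h.colors
      colorStart := by rw [hf₁.arrs _ (by decide)]; exact h.colorStart
      reps := fun i j => (hdecode _ (hindex i j)).trans (by rw [h.kernel, candidate])
      lt := fun i j => h.lt _ (candidate_mem_listOf hlt i j) }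
  refine Runs.seq (Runs.check he hcost h₁) (T₂ := 4) (fun s₂ hcheck hf₂ => ?_) le_rfl
  have hfound : s₂.regs Reg.found = s.regs Reg.found :=
    (hf₂.regs _ (by simp)).trans (hf₁.regs _ (by decide))
  refine Runs.branch (T₁ := 2) (fun hd => Runs.skip ?_ (by omega))
    (fun hd => Runs.assign ?_ (by simp)) (by simp)
  · rw [if_neg (mt hcheck.2 hd), hfound]
  · simp [if_pos (hcheck.1 hd)]

open Classical in
theorem Runs.searchLoop
    (he : ∀ s, e.eval s = if R (s.regs Reg.row) (s.regs Reg.col) then 1 else 0)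
    (hcost : e.cost ≤ 20) (h : HoldsKernel H n k w f s)
    (hcount : s.regs Reg.candidateCount = w ^ (k * k)) (hfound : s.regs Reg.found = 0) :
    Runs (.forLoop Reg.candidate Reg.candidateCount (.testCandidate e)) s
      (w ^ (k * k) * (k * k * (w ^ (k * k) * 14 + 22) + checkTime k + 20) + 6) (fun s' =>
      s'.regs Reg.found = if ∃ x, IsColoringWitness H (fun i j : Fin k => R i j) x ∧
        ∀ i j, x i j ∈ listOf f w then 1 else 0) := by
  simp only [← exists_candidate_iff]
  refine Runs.forLoop (T := k * k * (w ^ (k * k) * 14 + 22) + checkTime k + 12)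
    (N := w ^ (k * k)) (fun j s' => s'.regs Reg.found =
    if ∃ c < j, IsColoringWitness H (fun i j : Fin k => R i j) (candidate f w k c) then 1 else 0)
    (by simp +decide) (by simp +decide) (by decide) hcount (by simp +decide [hfound])
    fun j hj s₁ hj₁ hcandidate hf => ?_
  refine (Runs.testCandidate he hcost (h.frame hf (by simp +decide [Prog.forLoop])
    (by simp +decide [Prog.forLoop])) hcandidate hj).mono le_rfl fun s₂ h₂ _ => ?_
  rw [setReg_regs, if_neg (by decide), h₂, hj₁]
  simp only [Nat.lt_succ_iff_lt_or_eq, or_and_right, exists_or, exists_eq_left]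
  by_cases hj : IsColoringWitness H (fun i j : Fin k => R i j) (candidate f w k j) <;> simp [hj]

/-- Register `order` receives `1` if some of the vertices stored in array `kernel` form a witness,
and `0` otherwise. -/
def Prog.search (e : Expr) : Prog :=
  .seq (.multiples Arr.colorStart Reg.colors Reg.index Reg.product) (.seq .power
    (.seq (.assign Reg.found (.const 0)) (.seq
      (.forLoop Reg.candidate Reg.candidateCount (.testCandidate e))
      (.assign Reg.order (.reg Reg.found)))))

/-- A bound on the running time of `Prog.search` for `k` colors and a list of length `w`. -/
def searchTime (k w : ℕ) : ℕ :=
  w ^ (k * k) * (k * k * (w ^ (k * k) * 14 + 22) + checkTime k + 20) + k * k * (w * 12 + 18) +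
    k * 15 + 26

theorem searchTime_mono (k : ℕ) : Monotone (searchTime k) := by
  intro w w' h
  unfold searchTime
  gcongr

open Classical in
theorem Runs.search (he : ∀ s, e.eval s = if R (s.regs Reg.row) (s.regs Reg.col) then 1 else 0)
    (hcost : e.cost ≤ 20) (h : HoldsGraph H n s) (hcolors : s.regs Reg.colors = k)
    (hpairs : s.regs Reg.pairs = k * k)
    (hlt : ∀ v ∈ listOf (s.arrs Arr.kernel) (s.regs Reg.kernelSize), v < n) :
    Runs (.search e) s (searchTime k (s.regs Reg.kernelSize)) (fun s' => s'.regs Reg.order =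
      if ∃ x, IsColoringWitness H (fun i j : Fin k => R i j) x ∧
        ∀ i j, x i j ∈ listOf (s.arrs Arr.kernel) (s.regs Reg.kernelSize) then 1 else 0) := by
  generalize hw : s.regs Reg.kernelSize = w, hf : s.arrs Arr.kernel = f at *
  set L := w ^ (k * k) * (k * k * (w ^ (k * k) * 14 + 22) + checkTime k + 20)
  refine Runs.seq (Runs.multiples (by decide) (by decide) (by decide))
    (T₂ := L + k * k * (w * 12 + 18) + 18) (fun s₁ hstart hf₁ => ?_)
    (by rw [hcolors, searchTime]; omega)
  refine Runs.seq (Runs.power s₁) (T₂ := L + 10) (fun s₂ hpower hf₂ => Runs.assign_seq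
    (T₂ := L + 8) (Runs.seq (T₂ := 2)
      (Runs.searchLoop (n := n) (f := f) (w := w) he hcost ?_ ?_ (by simp))
      (fun s₃ hfound _ => Runs.assign (by simpa using hfound) (by simp)) (by omega))
    (by simp; omega)) (by simp +decide only [hf₁.regs, hpairs, hw]; omega)
  · exact {
      ((h.frame hf₁).frame hf₂).frame (.setReg (p := .assign Reg.found (.const 0)) (by decide)) with
      colors := by simp +decide [hf₂.regs, hf₁.regs, hcolors]
      pairs := by simp +decide [hf₂.regs, hf₁.regs, hpairs]
      kernelSize := by simp +decide [hf₂.regs, hf₁.regs, hw]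
      kernel := by simp +decide [hf₂.arrs, hf₁.arrs, hf]
      colorStart := fun i => by simp +decide [hf₂.arrs, hstart, hcolors]
      lt := hlt }
  · simpa +decide [hf₁.regs, hpairs, hw] using hpower

end Search

section Solve

open Classical in
theorem inputState_adj {n : ℕ} (G : SimpleGraph (Fin n)) (k t : ℕ) {u v : ℕ} (hu : u < n)
    (hv : v < n) :
    (inputState G k t).arrs Arr.adj (u * n + v) = if (natGraph G).Adj u v then 1 else 0 := by
  suffices h : (∃ i j : Fin n, u * n + v = (i : ℕ) * n + (j : ℕ) ∧ G.Adj i j) ↔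
      (natGraph G).Adj u v by
    simp only [inputState, h, true_and]
  rw [natGraph_adj hu hv]
  refine ⟨fun ⟨i, j, hij, hadj⟩ => ?_, fun hadj => ⟨⟨u, hu⟩, ⟨v, hv⟩, rfl, hadj⟩⟩
  have hpair : ((⟨u, hu⟩, ⟨v, hv⟩) : Fin n × Fin n) = (i, j) :=
    finProdFinEquiv.injective (Fin.ext (by simpa [add_comm, mul_comm] using hij))
  obtain ⟨rfl, rfl⟩ := Prod.mk.inj hpair
  exact hadj

/-- Set up the rows of the adjacency matrix, compute the thresholds, and collect the vertices of
high degree. -/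
def Prog.prepare : Prog :=
  .seq (.multiples Arr.rowStart Reg.order Reg.index Reg.product)
    (.seq (.mul Reg.pairs Reg.colors Reg.colors Reg.index) (.seq .thresholds .collectHighs))

/-- The vertices of `H` of degree at least `M` are stored in the state `s`, together with `H` and
the parameters for which the problem has to be decided; no vertex is marked. -/
structure HoldsHighs (H : SimpleGraph ℕ) [DecidableRel H.Adj] (n k M N : ℕ) (s : State) :
    Prop extends HoldsGraph H n s where
  colors : s.regs Reg.colors = k
  pairs : s.regs Reg.pairs = k * k
  degreeBound : s.regs Reg.degreeBound = M
  typeBound : s.regs Reg.typeBound = N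
  star : listOf (s.arrs Arr.star) (s.regs Reg.highCount) = highs H n M
  kernel : listOf (s.arrs Arr.kernel) (s.regs Reg.highCount) = highs H n M
  typeCount : s.arrs Arr.typeCount = 0

open Classical in
theorem Runs.prepare {n : ℕ} (G : SimpleGraph (Fin n)) (k t : ℕ) {M : ℕ}
    (hM : degreeThreshold k t = M) : Runs .prepare (inputState G k t)
      (n * 15 + (k * 12 + (thresholdsTime k M + n * (n * 16 + 30))) + 24)
      (HoldsHighs (natGraph G) n k M (M * M * (M * M))) := by
  refine Runs.seq (Runs.multiples (by decide) (by decide) (by decide))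
    (T₂ := k * 12 + (thresholdsTime k M + n * (n * 16 + 30)) + 16) (fun s₁ hrow hf₁ => ?_)
    (by simp [inputState]; omega)
  have hcolors : s₁.regs Reg.colors = k := hf₁.regs _ (by decide)
  refine Runs.seq (Runs.mul (by decide) (by decide) (by decide) (by decide) (by decide))
    (T₂ := thresholdsTime k M + n * (n * 16 + 30) + 8) (fun s₂ hpairs hf₂ => ?_)
    (by rw [hcolors]; omega)
  rw [hcolors] at hpairs
  have hbiclique : s₂.regs Reg.biclique = t :=
    (hf₂.regs _ (by decide)).trans (hf₁.regs _ (by decide))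
  have hthresholds := Runs.thresholds ((hf₂.regs _ (by decide)).trans hcolors) hbiclique hpairs
  rw [hM] at hthresholds
  refine Runs.seq hthresholds
    (T₂ := n * (n * 16 + 30) + 8) (fun s₃ ⟨hdegree, htype⟩ hf₃ => ?_) (by omega)
  have h₁ : HoldsGraph (natGraph G) n s₁ :=
    ⟨hf₁.regs _ (by decide), hrow, fun u hu v hv =>
      (congrFun (hf₁.arrs _ (by decide)) _).trans (inputState_adj G k t hu hv)⟩
  have h₃ : HoldsGraph (natGraph G) n s₃ := (h₁.frame hf₂).frame hf₃
  refine (Runs.collectHighs h₃).mono le_rfl fun s₄ ⟨hstar, hkernel⟩ hf₄ =>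
    { h₃.frame hf₄ with
      colors := ?_, pairs := ?_, degreeBound := ?_, typeBound := ?_, typeCount := ?_
      star := hdegree ▸ hstar
      kernel := hdegree ▸ hkernel }
  · simp +decide [hf₄.regs, hf₃.regs, hf₂.regs, hcolors]
  · simp +decide [hf₄.regs, hf₃.regs, hpairs]
  · simp +decide [hf₄.regs, hdegree]
  · simp +decide [hf₄.regs, htype]
  · simp +decide only [hf₄.arrs, hf₃.arrs, hf₂.arrs, hf₁.arrs]
    simp [inputState]
    rfl

/-- Accept if there are many vertices of high degree, and search a kernel otherwise. -/
def Prog.searchOrAccept (e : Expr) : Prog :=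
  .branch (.sub (.reg Reg.degreeBound) (.reg Reg.highCount)) (.seq .mark (.search e))
    (.assign Reg.order (.const 1))

open Classical in
theorem Runs.searchOrAccept {H : SimpleGraph ℕ} [DecidableRel H.Adj] {n k M N : ℕ} {s : State}
    {e : Expr} {R : ℕ → ℕ → Prop} [DecidableRel R]
    (he : ∀ s, e.eval s = if R (s.regs Reg.row) (s.regs Reg.col) then 1 else 0)
    (hcost : e.cost ≤ 20) (hH : ∀ v w, H.Adj v w → v < n ∧ w < n) (hN : k * k * (M * M) < N)
    (h : HoldsHighs H n k M N s)
    (haccept : M ≤ (highs H n M).length →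
      ∃ x, IsColoringWitness H (fun i j : Fin k => R i j) x ∧ ∀ i j, x i j < n) :
    Runs (.searchOrAccept e) s (markTime n M M + searchTime k (kernelBound M N) + 4) (fun s' =>
      s'.regs Reg.order = if ∃ x, IsColoringWitness H (fun i j : Fin k => R i j) x ∧
        ∀ i j, x i j < n then 1 else 0) := by
  have hlength : s.regs Reg.highCount = (highs H n M).length := by
    rw [← h.star, length_listOf]
  refine Runs.branch (T₁ := markTime n M M + searchTime k (kernelBound M N)) (fun hlt => ?_)
    (fun hle => ?_) (by simp; omega)
  · simp only [Expr.eval, h.degreeBound, hlength] at hlt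
    have hle : (highs H n M).length ≤ M := by omega
    have hmark := Runs.mark (A := highs H n M) h.toHoldsGraph
      (fun a ha => List.mem_range.1 (List.mem_filter.1 ha).1) h.star h.kernel h.typeCount
    rw [h.degreeBound, h.typeBound] at hmark
    refine Runs.seq hmark (T₂ := searchTime k (kernelBound M N)) (fun s₁ h₁ hf₁ => ?_) ?_
    · obtain ⟨S, -, hS⟩ := h₁.marked
      have hsize : s₁.regs Reg.kernelSize ≤ kernelBound M N := by
        simpa using hS.length_le_kernelBound hle
      refine (Runs.search he hcost h₁.toHoldsGraph ((hf₁.regs _ (by decide)).trans h.colors)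
        ((hf₁.regs _ (by decide)).trans h.pairs) hS.lt).mono (searchTime_mono k hsize)
        fun s₂ h₂ _ => h₂.trans (if_congr ⟨fun ⟨x, hx, hxW⟩ => ?_, fun ⟨x, hx, hxn⟩ => ?_⟩ rfl rfl)
      · exact ⟨x, hx, fun i j => hS.lt _ (hxW i j)⟩
      · exact hS.exists_isColoringWitness_mem hH (by omega) (by simpa using hN) hx hxn
    · exact Nat.add_le_add_right (by unfold markTime; gcongr) _
  · simp only [Expr.eval, h.degreeBound, hlength] at hle
    refine Runs.assign ?_ (by simp [markTime]; omega)
    simp [if_pos (haccept (Nat.le_of_sub_eq_zero hle))]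

/-- Decide whether a graph has a coloring witness, where the expression `e` evaluates the relation
of the two colors in the registers `row` and `col`. -/
def Prog.solve (e : Expr) : Prog := .seq .prepare (.searchOrAccept e)

/-- The factor of the running time of `Prog.solve` that depends on the parameters only. -/
def solveFactor (k t : ℕ) : ℕ :=
  let M := degreeThreshold k t
  37 + ((M + M) * ((M + M) * 58 + 30) + 104) +
    (k * 12 + thresholdsTime k M + searchTime k (kernelBound M (M * M * (M * M))) + 36)

theorem quadratic_le_mul_max_sq (a b c n : ℕ) :
    n ^ 2 * a + n * b + c ≤ (a + b + c) * max n 1 ^ 2 := by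
  have h₁ : 1 ≤ max n 1 ^ 2 := Nat.one_le_pow _ _ (by simp)
  have h₂ : n ^ 2 ≤ max n 1 ^ 2 := Nat.pow_le_pow_left (le_max_left _ _) 2
  have h₃ : n ≤ max n 1 ^ 2 := (Nat.le_self_pow two_ne_zero n).trans h₂
  nlinarith [Nat.mul_le_mul_right a h₂, Nat.mul_le_mul_right b h₃, Nat.mul_le_mul_right c h₁]

theorem Runs.solve {k t n : ℕ} {G : SimpleGraph (Fin n)}
    (hG : (completeBipartiteGraph (Fin t) (Fin t)).Free G) {R : ℕ → ℕ → Prop} [DecidableRel R]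
    (hR : ∀ i, ¬ R i i) {e : Expr}
    (he : ∀ s, e.eval s = if R (s.regs Reg.row) (s.regs Reg.col) then 1 else 0)
    (hcost : e.cost ≤ 20) :
    DecidesInTime (.solve e) (inputState G k t)
      (∃ x, IsColoringWitness G (fun i j : Fin k => R i j) x) (solveFactor k t * max n 1 ^ 2) := by
  classical
  rw [← exists_isColoringWitness_natGraph_iff]
  obtain ⟨M, hM⟩ : ∃ M, degreeThreshold k t = M := ⟨_, rfl⟩
  have hkM : k * k < M := hM ▸ mul_self_lt_degreeThreshold k t
  refine Runs.seq (Runs.prepare G k t hM) (fun s h _ => Runs.searchOrAccept he hcost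
    (fun _ _ => lt_of_natGraph_adj) ?_ h fun hhighs => ?_) ?_
  · exact Nat.mul_lt_mul_of_pos_right (hkM.trans_le (Nat.le_mul_self M))
      (Nat.mul_pos (by omega) (by omega))
  · rw [length_highs_natGraph] at hhighs
    exact exists_isColoringWitness_natGraph_iff.2
      (exists_isColoringWitness_of_degreeThreshold_le_card hG (fun i => hR i) (by simpa [hM])
        (by simp [hM]))
  · refine Eq.trans_le ?_ (quadratic_le_mul_max_sq _ _ _ n)
    simp only [hM, markTime]
    ring

end Solve

end RAM

theorem mainTheorem5 :
    (∃ (h : ℕ → ℕ → ℕ) (c : ℕ) (P : RAM.Prog),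
      ∀ (k t n : ℕ) (G : SimpleGraph (Fin n)), 0 < k →
        (completeBipartiteGraph (Fin t) (Fin t)).Free G →
        RAM.DecidesInTime P (RAM.inputState G k t) (BChromaticCoreProblem G k)
          (h k t * max n 1 ^ c)) ∧
    (∃ (h : ℕ → ℕ → ℕ) (c : ℕ) (P : RAM.Prog),
      ∀ (k t n : ℕ) (G : SimpleGraph (Fin n)), 0 < k →
        (completeBipartiteGraph (Fin t) (Fin t)).Free G →
        RAM.DecidesInTime P (RAM.inputState G k t) (PartialGrundyColoringProblem G k)
          (h k t * max n 1 ^ c)) := by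
  constructor
  · refine ⟨RAM.solveFactor, 2,
      .solve (.sub (.const 1) (.eq (.reg RAM.Reg.col) (.reg RAM.Reg.row))), fun k t n G _ hG => ?_⟩
    rw [bChromaticCoreProblem_iff]
    simp only [ne_eq, Fin.ext_iff]
    refine RAM.Runs.solve hG (R := fun i j => ¬ j = i) (by simp) (fun s => ?_)
      (by simp [RAM.Expr.cost])
    simp only [RAM.Expr.eval, RAM.eval_eq]
    split_ifs <;> simp_all
  · refine ⟨RAM.solveFactor, 2,
      .solve (.sub (.const 1) (.sub (.const 1) (.sub (.reg RAM.Reg.row) (.reg RAM.Reg.col)))),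
      fun k t n G _ hG => ?_⟩
    rw [partialGrundyColoringProblem_iff]
    refine RAM.Runs.solve hG (R := fun i j => j < i) (by simp) (fun s => ?_)
      (by simp [RAM.Expr.cost])
    simp only [RAM.Expr.eval]
    split_ifs <;> omega
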